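/- Fix matrices $A\in\mathbb R^{2\times2}$, $B\in\mathbb R^{2\times1}$, $C\in\mathbb R^{3\times2}$ and a gain $K\in\mathbb R^{1\times2}$. Let $\mathbb D_3(\mathbb R)$ be the space of real diagonal $3\times3$ matrices and let $$\Omega\subset \mathbb D_3(\mathbb R)\times\mathbb R^2\times\mathbb R^{3\times3}\times(\mathbb R^{3\times1})^2\times(\mathbb R^{1\times3})^2$$ be a compact set of parameters $S=(\Lambda^+;\Lambda^-,\Sigma^{--};\Sigma^{++};\Sigma^{+-},Q;\Sigma^{-+},R)$ such that $\Lambda^+=\operatorname{diag}(\lambda_1,\lambda_2,\lambda_3)$ with $\lambda_1,\lambda_2,\lambda_3>0$ and $\Lambda^->0$ for every $S\in\Omega$. Let $\mathcal T=\{(x,\xi):0\le\xi\le x\le1\}$, and for $S\in\Omega$ consider the kernel equations $$\begin{aligned} &\Lambda^-\partial_xK_0(x,\xi)=\partial_\xi K_0(x,\xi)\Lambda^++N_0(x,\xi)\Sigma^{-+}+K_0(x,\xi)(\Sigma^{++}-\Sigma^{--}\mathbf I_3),\\ &\Lambda^-\big(\partial_xN_0(x,\xi)+\partial_\xi N_0(x,\xi)\big)=K_0(x,\xi)\Sigma^{+-},\\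 &K_0(x,x)(\Lambda^-\mathbf I_3+\Lambda^+)=-\Sigma^{-+},\qquad \Lambda^-N_0(x,0)-K_0(x,0)\Lambda^+Q=\gamma(x)B,\\ &\Lambda^-\gamma'(x)=\gamma(x)A-\Sigma^{--}\gamma(x)-K_0(x,0)\Lambda^+C,\qquad \gamma(0)=K, \end{aligned}$$ for bounded measurable functions $K_0:\mathcal T\to\mathbb R^{1\times3}$, $N_0:\mathcal T\to\mathbb R$, $\gamma:[0,1]\to\mathbb R^{1\times2}$. The differential equations are understood in the broad sense, that is, integrated along the characteristic segments contained in $\mathcal T$ (of direction $(\Lambda^-,-\lambda_i)$ for the $i$-th component of $K_0$, of direction $(1,1)$ for $N_0$), respectively over $[0,x]$ for $\gamma$; all equations are imposed at every point. Let $\sigma:\mathbb R\to\mathbb R$ be any continuous function that is not a polynomial. A neural network is a feed-forward network with finitely many hidden layers of finite width, activation $\sigma$ and an affine output layer. A DeepONet is a map $$\hat{\mathcal K}(S)(x,\xi)=\sum_{i=1}^{b}g_i(S)\,f_i(x,\xi),$$ where $b\in\mathbb N$, the branch networks $g_i$ take the 26 scalar coordinates of $S$ to $\mathbb R$, and the trunk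 networks $f_i$ take $(x,\xi)$ to $\mathbb R^{1\times3}\times\mathbb R\times\mathbb R^{1\times2}\cong\mathbb R^6$. Then for every $S\in\Omega$ the kernel equations have exactly one solution $(K_0,N_0,\gamma)$, so that the operator $$\mathcal K(S)(x,\xi)=\big(K_0(x,\xi),N_0(x,\xi),\gamma(x)\big),\qquad S\in\Omega,$$ is well defined, and for every $\varepsilon>0$ there is a DeepONet $\hat{\mathcal K}=(\hat K_0,\hat N_0,\hat\gamma)$, whose last component $\hat\gamma$ does not depend on $\xi$, such that $$\big|\mathcal K(S)(x,\xi)-\hat{\mathcal K}(S)(x,\xi)\big|\le\varepsilon\qquad\text{for all }S\in\Omega\text{ and all }(x,\xi)\in\mathcal T,$$ where $|\cdot|$ is the Euclidean norm on $\mathbb R^6$. -/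

import Mathlib

open scoped Matrix

noncomputable section

/-! ## System parameters -/

/-- The parameter space `𝔻₃(ℝ) × ℝ² × ℝ^{3×3} × (ℝ^{3×1})² × (ℝ^{1×3})²`, a point of which is
`(Λ⁺; Λ⁻, Σ⁻⁻; Σ⁺⁺; Σ⁺⁻, Q; Σ⁻⁺, R)`.  A diagonal matrix is given by its diagonal
`(λ₁, λ₂, λ₃)`; columns and rows of length 3 are vectors `Fin 3 → ℝ`. -/
abbrev SystemParam : Type :=
  (Fin 3 → ℝ) × (ℝ × ℝ) × Matrix (Fin 3) (Fin 3) ℝ ×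
    ((Fin 3 → ℝ) × (Fin 3 → ℝ)) × ((Fin 3 → ℝ) × (Fin 3 → ℝ))

namespace SystemParam

/-- The diagonal `(λ₁, λ₂, λ₃)` of `Λ⁺`. -/
def lam (S : SystemParam) : Fin 3 → ℝ := S.1

/-- The matrix `Λ⁺ = diag(λ₁, λ₂, λ₃)`. -/
def lamPlus (S : SystemParam) : Matrix (Fin 3) (Fin 3) ℝ := Matrix.diagonal S.lam

/-- `Λ⁻`. -/
def lamMinus (S : SystemParam) : ℝ := S.2.1.1

/-- `Σ⁻⁻`. -/
def sigMM (S : SystemParam) : ℝ := S.2.1.2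

/-- `Σ⁺⁺`. -/
def sigPP (S : SystemParam) : Matrix (Fin 3) (Fin 3) ℝ := S.2.2.1

/-- `Σ⁺⁻` (a column). -/
def sigPM (S : SystemParam) : Fin 3 → ℝ := S.2.2.2.1.1

/-- `Q` (a column). -/
def Q (S : SystemParam) : Fin 3 → ℝ := S.2.2.2.1.2

/-- `Σ⁻⁺` (a row). -/
def sigMP (S : SystemParam) : Fin 3 → ℝ := S.2.2.2.2.1

/-- `R` (a row). -/
def R (S : SystemParam) : Fin 3 → ℝ := S.2.2.2.2.2

/-- Index set of the 26 scalar coordinates of a parameter. -/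
abbrev Idx : Type :=
  Fin 3 ⊕ Fin 2 ⊕ (Fin 3 × Fin 3) ⊕ (Fin 3 ⊕ Fin 3) ⊕ (Fin 3 ⊕ Fin 3)

/-- The list of all scalar coordinates of a parameter. -/
def coords (S : SystemParam) : Idx → ℝ :=
  Sum.elim S.lam <| Sum.elim ![S.lamMinus, S.sigMM] <|
    Sum.elim (fun ij => S.sigPP ij.1 ij.2) <|
      Sum.elim (Sum.elim S.sigPM S.Q) (Sum.elim S.sigMP S.R)

end SystemParam

/-! ## Kernel equations -/

/-- The triangle `{(x, ξ) : 0 ≤ ξ ≤ x ≤ 1}`. -/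
def triangle : Set (ℝ × ℝ) := {p | 0 ≤ p.2 ∧ p.2 ≤ p.1 ∧ p.1 ≤ 1}

/-- A triple `(K₀, N₀, γ)`.  Only the values of `K₀`, `N₀` on the triangle and of `γ` on `[0, 1]`
matter. -/
structure KernelTriple where
  /-- the row `K₀(x, ξ)` -/
  K : ℝ → ℝ → Fin 3 → ℝ
  /-- the scalar `N₀(x, ξ)` -/
  N : ℝ → ℝ → ℝ
  /-- the row `γ(x)` -/
  γ : ℝ → Fin 2 → ℝ

namespace KernelTriple

/-- Equality of the kernels as functions on the triangle and on `[0, 1]`. -/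
def EqOnDomain (k l : KernelTriple) : Prop :=
  (∀ x ξ, (x, ξ) ∈ triangle → k.K x ξ = l.K x ξ ∧ k.N x ξ = l.N x ξ) ∧
    ∀ x ∈ Set.Icc (0 : ℝ) 1, k.γ x = l.γ x

/-- Index set of the components of `(K₀, N₀, γ)`. -/
abbrev Idx : Type := Fin 3 ⊕ Unit ⊕ Fin 2

/-- The vector `(K₀(x, ξ), N₀(x, ξ), γ(x)) ∈ ℝ³ × ℝ × ℝ² = ℝ⁶`. -/
def value (k : KernelTriple) (x ξ : ℝ) : Idx → ℝ :=
  Sum.elim (k.K x ξ) (Sum.elim (fun _ => k.N x ξ) (k.γ x))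

end KernelTriple

/-- `(K₀, N₀, γ)` is a bounded measurable solution of the kernel equations

* `Λ⁻ ∂ₓK₀ = ∂_ξK₀ Λ⁺ + N₀ Σ⁻⁺ + K₀ (Σ⁺⁺ - Σ⁻⁻ I)`,
* `Λ⁻ (∂ₓN₀ + ∂_ξN₀) = K₀ Σ⁺⁻`,
* `K₀(x, x) (Λ⁻ I + Λ⁺) = -Σ⁻⁺`,
* `Λ⁻ N₀(x, 0) - K₀(x, 0) Λ⁺ Q = γ(x) B`,
* `Λ⁻ γ'(x) = γ(x) A - Σ⁻⁻ γ(x) - K₀(x, 0) Λ⁺ C`, `γ(0) = Kg`,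

where `Kg` is the given feedback gain of the ODE.  As the solutions are only bounded functions,
the differential equations are understood in the usual (broad) sense: since `Λ⁺` is diagonal,
the first one says that the derivative of the `i`-th component of `K₀` in the direction
`(Λ⁻, -λᵢ)` is the `i`-th component of `N₀ Σ⁻⁺ + K₀ (Σ⁺⁺ - Σ⁻⁻ I)`, the second one that `Λ⁻`
times the derivative of `N₀` in the direction `(1, 1)` is `K₀ Σ⁺⁻`, and each equation is imposed
in integrated form along every segment in its characteristic direction inside the triangle. -/
structure IsKernelSolution (A : Matrix (Fin 2) (Fin 2) ℝ) (B : Fin 2 → ℝ)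
    (C : Matrix (Fin 3) (Fin 2) ℝ) (Kg : Fin 2 → ℝ) (S : SystemParam) (k : KernelTriple) :
    Prop where
  measurable_K : ∀ i, Measurable fun p : triangle => k.K p.1.1 p.1.2 i
  measurable_N : Measurable fun p : triangle => k.N p.1.1 p.1.2
  measurable_γ : ∀ j, Measurable fun x : Set.Icc (0 : ℝ) 1 => k.γ x.1 j
  bounded : ∃ M : ℝ,
    (∀ x ξ, (x, ξ) ∈ triangle → (∀ i, |k.K x ξ i| ≤ M) ∧ |k.N x ξ| ≤ M) ∧
      ∀ x ∈ Set.Icc (0 : ℝ) 1, ∀ j, |k.γ x j| ≤ M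
  eq_K : ∀ (i : Fin 3) (x ξ s : ℝ), 0 ≤ s → (x, ξ) ∈ triangle →
    (x + S.lamMinus * s, ξ - S.lam i * s) ∈ triangle →
    k.K (x + S.lamMinus * s) (ξ - S.lam i * s) i - k.K x ξ i =
      ∫ t in (0 : ℝ)..s,
        (k.N (x + S.lamMinus * t) (ξ - S.lam i * t) • S.sigMP +
          k.K (x + S.lamMinus * t) (ξ - S.lam i * t) ᵥ*
            (S.sigPP - S.sigMM • (1 : Matrix (Fin 3) (Fin 3) ℝ))) i
  eq_N : ∀ x ξ s : ℝ, 0 ≤ s → (x, ξ) ∈ triangle → (x + s, ξ + s) ∈ triangle →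
    S.lamMinus * (k.N (x + s) (ξ + s) - k.N x ξ) =
      ∫ t in (0 : ℝ)..s, k.K (x + t) (ξ + t) ⬝ᵥ S.sigPM
  diag_K : ∀ x ∈ Set.Icc (0 : ℝ) 1,
    k.K x x ᵥ* (S.lamMinus • (1 : Matrix (Fin 3) (Fin 3) ℝ) + S.lamPlus) = -S.sigMP
  bottom_N : ∀ x ∈ Set.Icc (0 : ℝ) 1,
    S.lamMinus * k.N x 0 - (k.K x 0 ᵥ* S.lamPlus) ⬝ᵥ S.Q = k.γ x ⬝ᵥ B
  eq_γ : ∀ x ∈ Set.Icc (0 : ℝ) 1, ∀ j : Fin 2,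
    S.lamMinus * (k.γ x j - k.γ 0 j) =
      ∫ t in (0 : ℝ)..x,
        (k.γ t ᵥ* A - S.sigMM • k.γ t - (k.K t 0 ᵥ* S.lamPlus) ᵥ* C) j
  init_γ : k.γ 0 = Kg

/-! ## Neural networks and DeepONets -/

/-- Feed-forward neural networks (weights and biases) with outputs indexed by `κ` and inputs
indexed by the second argument: finitely many hidden layers of finite width, followed by an
affine output layer. -/
inductive NeuralNet (κ : Type) : Type → Type 1 where
  | output {ι : Type} (W : Matrix κ ι ℝ) (b : κ → ℝ) : NeuralNet κ ι
  | hidden {ι : Type} (n : ℕ) (W : Matrix (Fin n) ι ℝ) (b : Fin n → ℝ)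
      (next : NeuralNet κ (Fin n)) : NeuralNet κ ι

/-- The function computed by a network when every hidden unit applies the activation `σ`. -/
def NeuralNet.eval (σ : ℝ → ℝ) {κ : Type} :
    {ι : Type} → [Fintype ι] → NeuralNet κ ι → (ι → ℝ) → κ → ℝ
  | _, _, .output W b, v => W *ᵥ v + b
  | _, _, .hidden _ W b next, v => next.eval σ fun j => σ ((W *ᵥ v + b) j)

/-- A DeepONet: `b` scalar branch networks, which read the input of the operator, and `b` trunk
networks, which read the point where the output function is evaluated. -/
structure DeepONet (ι τ κ : Type) where
  /-- the number of branch and trunk networks -/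
  b : ℕ
  /-- the branch networks -/
  branch : Fin b → NeuralNet Unit ι
  /-- the trunk networks -/
  trunk : Fin b → NeuralNet κ τ

/-- `𝒢(u)(y) = ∑ᵢ gᵢ(u) fᵢ(y)`, with branch networks `gᵢ` and trunk networks `fᵢ`. -/
def DeepONet.eval (σ : ℝ → ℝ) {ι τ κ : Type} [Fintype ι] [Fintype τ] (G : DeepONet ι τ κ)
    (u : ι → ℝ) (y : τ → ℝ) : κ → ℝ :=
  ∑ i, (G.branch i).eval σ u () • (G.trunk i).eval σ y

end

noncomputable section

/-! ## Density of networks with one hidden layer -/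

section Ridge

open MeasureTheory Filter Topology ContDiff

/-! Integrating along characteristics turns the kernel equations into a fixed point equation for
`picard`: each component of `K₀` is transported from the diagonal, `N₀` from the bottom edge, and
`γ` solves an integrated ODE. In a sup norm weighted by an exponential in `x` and by a larger factor
on `N₀`, the map `picard` halves distances (`Near.picard`). By compactness of `Ω` the same weights
serve all parameters. Hence bounded measurable solutions are unique (`IsPicardFixed.eqOnDomain`).

Banach's theorem is applied once, in the space of continuous functions on `Ω × triangle`
(`exists_fixed_ofFun`), not separately for each parameter. The solution is therefore jointly
continuous in the parameter and the point, which is all that approximation needs.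

It remains to approximate a continuous function on a product of compact sets by sums of products of
a neuron in `S` and a neuron in `(x, ξ)` (`exists_sum_neuron_mul_neuron`). For continuous
nonpolynomial `σ`, a closed space containing the ridge functions `σ (w * l + b)` contains mollified
ridge functions, then their derivatives in `w`, hence all powers of `l`, and by Weierstrass every `u
∘ l` (`ridge_comp_mem`). With `u = exp` in each factor, Stone–Weierstrass finishes. -/

/-- The quotient map by the closed space `W` is continuous and linear, so it commutes with the
integral, and it kills the integrand. -/
theorem Submodule.integral_mem_of_isClosed {E α : Type*} [NormedAddCommGroup E] [NormedSpace ℝ E]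
    [CompleteSpace E] [MeasurableSpace α] {μ : Measure α} (W : Submodule ℝ E)
    (hW : IsClosed (W : Set E)) {f : α → E} (hf : Integrable f μ) (h : ∀ a, f a ∈ W) :
    ∫ a, f a ∂μ ∈ W := by
  have := hW
  rw [← Submodule.Quotient.mk_eq_zero]
  have h1 := W.mkQL.integral_comp_comm hf
  have h2 : ∀ a, W.mkQL (f a) = 0 := fun a => (Submodule.Quotient.mk_eq_zero W).2 (h a)
  simp only [h2, integral_zero] at h1
  exact h1.symm

theorem Submodule.hasDerivAt_mem_of_isClosed {E : Type*} [NormedAddCommGroup E] [NormedSpace ℝ E]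
    (W : Submodule ℝ E) (hW : IsClosed (W : Set E)) {F : ℝ → E} {F' : E} {x : ℝ}
    (hF : HasDerivAt F F' x) (h : ∀ w, F w ∈ W) : F' ∈ W :=
  hW.mem_of_tendsto hF.tendsto_slope <|
    Eventually.of_forall fun y => W.smul_mem _ (W.sub_mem (h y) (h x))

theorem exists_polynomial_of_iteratedDeriv_eq_zero (k : ℕ) :
    ∀ f : ℝ → ℝ, ContDiff ℝ ∞ f → (∀ x, iteratedDeriv k f x = 0) →
      ∃ c : ℕ → ℝ, ∀ x, f x = ∑ i ∈ Finset.range k, c i * x ^ i := by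
  induction k with
  | zero => intro f _ h; exact ⟨0, fun x => by simpa using h x⟩
  | succ k ih =>
    intro f hf h
    have hd : ContDiff ℝ ∞ (deriv f) := (contDiff_infty_iff_deriv.1 hf).2
    obtain ⟨c, hc⟩ := ih (deriv f) hd fun x => by rw [← iteratedDeriv_succ']; exact h x
    have hdiff : Differentiable ℝ f := (contDiff_infty_iff_deriv.1 hf).1
    set P : ℝ → ℝ := fun x => ∑ i ∈ Finset.range k, c i / (i + 1) * x ^ (i + 1)
    have hP : ∀ x, HasDerivAt P (deriv f x) x := by
      intro x
      rw [hc x]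
      refine HasDerivAt.fun_sum fun i _ => ?_
      refine ((hasDerivAt_pow (i + 1) x).const_mul (c i / (i + 1))).congr_deriv ?_
      have hi : (i : ℝ) + 1 ≠ 0 := by positivity
      rw [Nat.add_sub_cancel, Nat.cast_succ, ← mul_assoc, div_mul_cancel₀ _ hi]
    have hconst : ∀ x, f x - P x = f 0 - P 0 := by
      have h0 : ∀ x, HasDerivAt (fun x => f x - P x) 0 x := fun x => by
        simpa using (hdiff x).hasDerivAt.fun_sub (hP x)
      intro x
      exact is_const_of_deriv_eq_zero (fun x => (h0 x).differentiableAt)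
        (fun x => (h0 x).deriv) x 0
    -- The coefficients of the antiderivative `P`, plus the constant of integration; the truncated
    -- `i - 1` is read only for `i ≥ 1`.
    refine ⟨fun i => if i = 0 then f 0 - P 0 else c (i - 1) / ((i - 1 : ℕ) + 1), fun x => ?_⟩
    rw [Finset.sum_range_succ']
    simp only [Nat.add_eq_zero_iff, one_ne_zero, and_false, if_false, Nat.add_sub_cancel, if_true,
      pow_zero, mul_one]
    rw [← hconst x]
    simp [P]

/-- Polynomials of degree below `k` are determined by their values at `0, …, k - 1` through Lagrange
interpolation, and these values converge. The uniform degree bound is essential. -/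
theorem exists_polynomial_of_tendsto {k : ℕ} {f : ℕ → ℝ → ℝ} {g : ℝ → ℝ}
    (hf : ∀ n, ∃ c : ℕ → ℝ, ∀ x, f n x = ∑ i ∈ Finset.range k, c i * x ^ i)
    (hlim : ∀ x, Tendsto (fun n => f n x) atTop (𝓝 (g x))) :
    ∃ p : Polynomial ℝ, ∀ x, g x = p.eval x := by
  have hinj : Set.InjOn (fun i : ℕ => (i : ℝ)) (Finset.range k : Set ℕ) :=
    Nat.cast_injective.injOn
  have hint : ∀ n x, f n x =
      ∑ i ∈ Finset.range k, f n i * (Lagrange.basis (Finset.range k) (fun i : ℕ => (i : ℝ)) i).eval x := by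
    intro n x
    obtain ⟨c, hc⟩ := hf n
    set p : Polynomial ℝ := ∑ i ∈ Finset.range k, Polynomial.C (c i) * Polynomial.X ^ i
    have hp : ∀ x, p.eval x = f n x := fun x => by
      simp [p, hc, Polynomial.eval_finsetSum]
    have hdeg : p.degree < (Finset.range k).card := by
      rw [Finset.card_range]
      refine (Polynomial.degree_sum_le _ _).trans_lt ?_
      refine (Finset.sup_lt_iff (WithBot.bot_lt_coe k)).2 fun i hi => ?_
      refine (Polynomial.degree_C_mul_X_pow_le _ _).trans_lt ?_
      exact WithBot.coe_lt_coe.2 (Finset.mem_range.1 hi)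
    have := congrArg (Polynomial.eval x) (Lagrange.eq_interpolate hinj hdeg)
    rw [hp] at this
    rw [this, Lagrange.interpolate_apply, Polynomial.eval_finsetSum]
    simp [hp]
  refine ⟨∑ i ∈ Finset.range k,
    Polynomial.C (g i) * Lagrange.basis (Finset.range k) (fun i : ℕ => (i : ℝ)) i, fun x => ?_⟩
  refine tendsto_nhds_unique (hlim x) ?_
  simp only [hint _ x, Polynomial.eval_finsetSum, Polynomial.eval_mul, Polynomial.eval_C]
  exact tendsto_finsetSum _ fun i _ => (hlim i).mul_const _

/-- A continuous function which is not a polynomial has a mollification whose `k`-th derivative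
does not vanish identically. -/
theorem exists_iteratedDeriv_convolution_ne_zero {σ : ℝ → ℝ} (hσ : Continuous σ)
    (hσ' : ¬ ∃ p : Polynomial ℝ, ∀ t, σ t = p.eval t) (k : ℕ) :
    ∃ φ : ℝ → ℝ, Continuous φ ∧ HasCompactSupport φ ∧
      ContDiff ℝ ∞ (fun t => ∫ s, φ s * σ (t - s)) ∧
        ∃ b, iteratedDeriv k (fun t => ∫ s, φ s * σ (t - s)) b ≠ 0 := by
  -- Otherwise every mollification of `σ` is a polynomial of degree below `k`; letting the bump
  -- radius tend to zero makes `σ` a polynomial.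
  by_contra hcon
  let φ : ℕ → ContDiffBump (0 : ℝ) := fun n =>
    ⟨1 / ((n : ℝ) + 1) / 2, 1 / ((n : ℝ) + 1), by positivity, half_lt_self (by positivity)⟩
  have hconv : ∀ n, (fun t => ∫ s, (φ n).normed volume s * σ (t - s)) =
      convolution ((φ n).normed volume) σ (ContinuousLinearMap.lsmul ℝ ℝ) volume := by
    intro n; ext t; simp [convolution]
  have hsm : ∀ n, ContDiff ℝ ∞ (fun t => ∫ s, (φ n).normed volume s * σ (t - s)) := by
    intro n
    rw [hconv]
    exact HasCompactSupport.contDiff_convolution_left _ (φ n).hasCompactSupport_normed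
      (φ n).contDiff_normed hσ.locallyIntegrable
  refine hσ' (exists_polynomial_of_tendsto (k := k)
    (f := fun n t => ∫ s, (φ n).normed volume s * σ (t - s)) (fun n => ?_) fun x => ?_)
  · refine exists_polynomial_of_iteratedDeriv_eq_zero k _ (hsm n) fun x => ?_
    by_contra hx
    exact hcon ⟨_, (φ n).continuous_normed, (φ n).hasCompactSupport_normed, hsm n, x, hx⟩
  · have h0 : Tendsto (fun n => (φ n).rOut) atTop (𝓝 0) := tendsto_one_div_add_atTop_nhds_zero_nat
    have := ContDiffBump.convolution_tendsto_right_of_continuous (μ := volume) h0 hσ x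
    simpa only [← hconv] using this

variable {X : Type*} [TopologicalSpace X] [CompactSpace X]

/-- The convolution is a Bochner integral in `C(X, ℝ)` of multiples of ridge functions with bias `b
- s`. -/
theorem ridge_convolution_mem {σ : ℝ → ℝ} (hσ : Continuous σ) (W : Submodule ℝ C(X, ℝ))
    (hW : IsClosed (W : Set C(X, ℝ))) (l : C(X, ℝ))
    (h : ∀ (w b : ℝ) (f : C(X, ℝ)), (∀ x, f x = σ (w * l x + b)) → f ∈ W)
    {φ : ℝ → ℝ} (hφ : Continuous φ) (hφc : HasCompactSupport φ) (w b : ℝ) (f : C(X, ℝ))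
    (hf : ∀ x, f x = ∫ s, φ s * σ (w * l x + b - s)) : f ∈ W := by
  let G : C(ℝ, C(X, ℝ)) := ContinuousMap.curry
    ⟨fun p : ℝ × X => φ p.1 * σ (w * l p.2 + b - p.1), by fun_prop⟩
  have hGsupp : HasCompactSupport G := by
    refine hφc.mono' fun s hs => subset_tsupport _ fun h0 => hs ?_
    ext x
    simp [G, h0]
  have hGi : Integrable G := G.continuous.integrable_of_hasCompactSupport hGsupp
  have hmem : ∫ s, G s ∈ W := by
    refine W.integral_mem_of_isClosed hW hGi fun s => ?_
    let g : C(X, ℝ) := ⟨fun x => σ (w * l x + (b - s)), by fun_prop⟩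
    have : G s = φ s • g := by ext x; simp [G, g, add_sub_assoc]
    rw [this]
    exact W.smul_mem _ (h w (b - s) g fun x => rfl)
  convert hmem
  ext x
  rw [hf]
  exact (ContinuousMap.evalCLM ℝ x).integral_comp_comm hGi

/-- Differentiating in the weight `w` brings down a factor `l` and stays in the closed space. -/
theorem ridge_iteratedDeriv_mem (W : Submodule ℝ C(X, ℝ)) (hW : IsClosed (W : Set C(X, ℝ)))
    (l : C(X, ℝ)) {g : ℝ → ℝ} (hg : ContDiff ℝ ∞ g) (b : ℝ)
    (h : ∀ (w : ℝ) (f : C(X, ℝ)), (∀ x, f x = g (w * l x + b)) → f ∈ W) (k : ℕ) :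
    ∀ (w : ℝ) (f : C(X, ℝ)), (∀ x, f x = l x ^ k * iteratedDeriv k g (w * l x + b)) → f ∈ W := by
  have hcont : ∀ k : ℕ, Continuous (iteratedDeriv k g) := fun k =>
    hg.continuous_iteratedDeriv k (by exact_mod_cast le_top)
  induction k with
  | zero => simpa using h
  | succ k ih =>
    intro w f hf
    let F : ℕ → C(ℝ, C(X, ℝ)) := fun k => ContinuousMap.curry
      ⟨fun p : ℝ × X => l p.2 ^ k * iteratedDeriv k g (p.1 * l p.2 + b), by
        have := hcont k; fun_prop⟩
    have hF : ∀ k w x, F k w x = l x ^ k * iteratedDeriv k g (w * l x + b) := fun _ _ _ => rfl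
    -- Writing the curve `F k` as the integral of the continuous curve `F (k + 1)` yields
    -- differentiability in the sup norm without uniform remainder estimates.
    have hint : ∀ u, F k 0 + ∫ v in (0 : ℝ)..u, F (k + 1) v = F k u := by
      intro u
      ext x
      have h1 := (ContinuousMap.evalCLM ℝ x).intervalIntegral_comp_comm
        ((F (k + 1)).continuous.intervalIntegrable (μ := volume) 0 u)
      have h2 : ∫ v in (0 : ℝ)..u, F (k + 1) v x = F k u x - F k 0 x := by
        refine intervalIntegral.integral_eq_sub_of_hasDerivAt (f := fun v => F k v x)
          (fun v _ => ?_) ?_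
        · simp only [hF]
          have hd : HasDerivAt (iteratedDeriv k g) (iteratedDeriv (k + 1) g (v * l x + b))
              (v * l x + b) := by
            rw [iteratedDeriv_succ]
            exact ((hg.differentiable_iteratedDeriv k
              (by exact_mod_cast WithTop.coe_lt_top _)) _).hasDerivAt
          have hi : HasDerivAt (fun v => v * l x + b) (l x) v := by
            simpa using ((hasDerivAt_id v).mul_const (l x)).add_const b
          refine ((hd.comp v hi).const_mul (l x ^ k)).congr_deriv ?_
          ring
        · refine Continuous.intervalIntegrable ?_ _ _
          simp only [hF]
          have := hcont (k + 1)
          fun_prop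
      have h3 : (∫ v in (0 : ℝ)..u, F (k + 1) v) x = ∫ v in (0 : ℝ)..u, F (k + 1) v x := h1.symm
      rw [ContinuousMap.add_apply, h3, h2]
      ring
    have hder : HasDerivAt (F k) (F (k + 1) w) w := by
      have := ((F (k + 1)).continuous.integral_hasStrictDerivAt 0 w).hasDerivAt.const_add (F k 0)
      simpa only [hint] using this
    have hfF : f = F (k + 1) w := by ext x; rw [hf, hF]
    rw [hfF]
    exact W.hasDerivAt_mem_of_isClosed hW hder fun w => ih w _ (hF k w)

/-- A closed space of continuous functions which contains the ridge functions
`σ (w * l + b)` contains all continuous functions of `l`. -/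
theorem ridge_comp_mem {σ : ℝ → ℝ} (hσ : Continuous σ)
    (hσ' : ¬ ∃ p : Polynomial ℝ, ∀ t, σ t = p.eval t) (W : Submodule ℝ C(X, ℝ))
    (hW : IsClosed (W : Set C(X, ℝ))) (l : C(X, ℝ))
    (h : ∀ (w b : ℝ) (f : C(X, ℝ)), (∀ x, f x = σ (w * l x + b)) → f ∈ W)
    {u : ℝ → ℝ} (hu : Continuous u) (f : C(X, ℝ)) (hf : ∀ x, f x = u (l x)) : f ∈ W := by
  have hpow : ∀ k : ℕ, l ^ k ∈ W := by
    intro k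
    obtain ⟨φ, hφ, hφc, hsm, b, hb⟩ := exists_iteratedDeriv_convolution_ne_zero hσ hσ' k
    -- At `w = 0` the differentiated ridge function is a nonzero constant times `l ^ k`.
    have h1 := ridge_iteratedDeriv_mem W hW l hsm b
      (fun w f hf => ridge_convolution_mem hσ W hW l h hφ hφc w b f hf) k 0
      (iteratedDeriv k (fun t => ∫ s, φ s * σ (t - s)) b • l ^ k) (fun x => by simp [mul_comm])
    exact (W.smul_mem_iff hb).1 h1
  have hpoly : ∀ p : Polynomial ℝ, Polynomial.aeval l p ∈ W := by
    intro p
    rw [Polynomial.aeval_eq_sum_range]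
    exact W.sum_mem fun i _ => W.smul_mem _ (hpow i)
  have hcl : f ∈ closure (W : Set C(X, ℝ)) := by
    rw [Metric.mem_closure_iff]
    intro ε hε
    obtain ⟨p, hp⟩ := exists_polynomial_near_of_continuousOn (-‖l‖) ‖l‖ u hu.continuousOn (ε / 2)
      (by positivity)
    refine ⟨_, hpoly p, ?_⟩
    refine lt_of_le_of_lt ((ContinuousMap.dist_le (by positivity)).2 fun x => ?_) (half_lt_self hε)
    rw [dist_comm, Real.dist_eq, hf]
    have hx : (Polynomial.aeval l p) x = p.eval (l x) := by
      simp [Polynomial.aeval_eq_sum_range, Polynomial.eval_eq_sum_range]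
    rw [hx]
    exact (hp _ (abs_le.1 (l.norm_coe_le_norm x))).le
  rwa [hW.closure_eq] at hcl

end Ridge

/-! ### Density of products of neurons on a product space -/

section Density

open Topology

/-- `ridge_comp_mem` applied to the preimage of `W` under multiplication by the frozen factor `H`.
-/
theorem ridge_comp_mul_mem {Z : Type*} [TopologicalSpace Z] [CompactSpace Z] {σ : ℝ → ℝ}
    (hσ : Continuous σ) (hσ' : ¬ ∃ p : Polynomial ℝ, ∀ t, σ t = p.eval t)
    (W : Submodule ℝ C(Z, ℝ)) (hW : IsClosed (W : Set C(Z, ℝ))) (l H : C(Z, ℝ))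
    (h : ∀ (w b : ℝ) (f : C(Z, ℝ)), (∀ z, f z = H z * σ (w * l z + b)) → f ∈ W)
    {u : ℝ → ℝ} (hu : Continuous u) (f : C(Z, ℝ)) (hf : ∀ z, f z = H z * u (l z)) : f ∈ W := by
  have hcl : IsClosed ((W.comap (LinearMap.mulLeft ℝ H) : Submodule ℝ C(Z, ℝ)) : Set C(Z, ℝ)) :=
    hW.preimage (continuous_const_mul H)
  have := ridge_comp_mem hσ hσ' (W.comap (LinearMap.mulLeft ℝ H)) hcl l
    (fun w b g hg => h w b (H * g) fun z => by simp [hg]) hu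
    ⟨fun z => u (l z), by fun_prop⟩ fun z => rfl
  have hfe : f = LinearMap.mulLeft ℝ H ⟨fun z => u (l z), by fun_prop⟩ := by
    ext z; simp [hf]
  rw [hfe]
  exact this

/-- Exponentials are closed under multiplication, so their span is already an algebra; it separates
points because `p` and `q` are injective, and Stone–Weierstrass applies. -/
theorem span_exp_dotProduct_dense {X Y ι τ : Type*} [TopologicalSpace X] [CompactSpace X]
    [TopologicalSpace Y] [CompactSpace Y] [Fintype ι] [Fintype τ] {p : X → ι → ℝ} {q : Y → τ → ℝ}
    (hp : Continuous p) (hp' : p.Injective) (hq : Continuous q) (hq' : q.Injective)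
    (W : Submodule ℝ C(X × Y, ℝ)) (hW : IsClosed (W : Set C(X × Y, ℝ)))
    (h : ∀ (a : ι → ℝ) (d : τ → ℝ) (f : C(X × Y, ℝ)),
      (∀ z, f z = Real.exp (a ⬝ᵥ p z.1) * Real.exp (d ⬝ᵥ q z.2)) → f ∈ W)
    (F : C(X × Y, ℝ)) : F ∈ W := by
  classical
  let M : Submonoid C(X × Y, ℝ) :=
    { carrier := {f | ∃ (a : ι → ℝ) (d : τ → ℝ), ∀ z,
        f z = Real.exp (a ⬝ᵥ p z.1) * Real.exp (d ⬝ᵥ q z.2)}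
      one_mem' := ⟨0, 0, fun z => by simp⟩
      mul_mem' := by
        rintro f g ⟨a, d, hf⟩ ⟨a', d', hg⟩
        refine ⟨a + a', d + d', fun z => ?_⟩
        rw [ContinuousMap.mul_apply, hf, hg, add_dotProduct, add_dotProduct, Real.exp_add,
          Real.exp_add]
        ring }
  let 𝒜 := Algebra.adjoin ℝ (M : Set C(X × Y, ℝ))
  have hsep : 𝒜.SeparatesPoints := by
    intro z w hzw
    have hcase : p z.1 ≠ p w.1 ∨ q z.2 ≠ q w.2 := by
      by_contra! hc
      exact hzw (Prod.ext (hp' hc.1) (hq' hc.2))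
    have key : ∀ (a : ι → ℝ) (d : τ → ℝ),
        Real.exp (a ⬝ᵥ p z.1) * Real.exp (d ⬝ᵥ q z.2) ≠
          Real.exp (a ⬝ᵥ p w.1) * Real.exp (d ⬝ᵥ q w.2) →
        ∃ f ∈ (fun f : C(X × Y, ℝ) => (f : X × Y → ℝ)) '' (𝒜 : Set C(X × Y, ℝ)), f z ≠ f w := by
      intro a d hne
      let f : C(X × Y, ℝ) := ⟨fun z => Real.exp (a ⬝ᵥ p z.1) * Real.exp (d ⬝ᵥ q z.2), by
        simp only [dotProduct]; fun_prop⟩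
      exact ⟨f, ⟨f, Algebra.subset_adjoin ⟨a, d, fun z => rfl⟩, rfl⟩, hne⟩
    rcases hcase with hc | hc
    · obtain ⟨i, hi⟩ := Function.ne_iff.1 hc
      exact key (Pi.single i 1) 0 (by simpa using hi)
    · obtain ⟨i, hi⟩ := Function.ne_iff.1 hc
      exact key 0 (Pi.single i 1) (by simpa using hi)
  have htop := ContinuousMap.subalgebra_topologicalClosure_eq_top_of_separatesPoints 𝒜 hsep
  have hF : F ∈ 𝒜.topologicalClosure := htop ▸ Algebra.mem_top
  have hsub : (𝒜 : Set C(X × Y, ℝ)) ⊆ W := by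
    have : Subalgebra.toSubmodule 𝒜 ≤ W := by
      rw [Algebra.adjoin_eq_span, Submonoid.closure_eq, Submodule.span_le]
      rintro f ⟨a, d, hf⟩
      exact h a d f hf
    exact this
  exact closure_minimal hsub hW hF

/-- Finite sums of products of two neurons are dense in the continuous functions on a product. -/
theorem exists_sum_neuron_mul_neuron {X Y ι τ : Type*} [TopologicalSpace X] [CompactSpace X]
    [TopologicalSpace Y] [CompactSpace Y] [Fintype ι] [Fintype τ] {σ : ℝ → ℝ}
    (hσ : Continuous σ) (hσ' : ¬ ∃ p : Polynomial ℝ, ∀ t, σ t = p.eval t)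
    {p : X → ι → ℝ} {q : Y → τ → ℝ}
    (hp : Continuous p) (hp' : p.Injective) (hq : Continuous q) (hq' : q.Injective)
    (F : C(X × Y, ℝ)) {ε : ℝ} (hε : 0 < ε) :
    ∃ (n : ℕ) (c : Fin n → ℝ) (a : Fin n → ι → ℝ) (b : Fin n → ℝ) (d : Fin n → τ → ℝ)
      (e : Fin n → ℝ), ∀ x y,
        |F (x, y) - ∑ i, c i * σ (a i ⬝ᵥ p x + b i) * σ (d i ⬝ᵥ q y + e i)| ≤ ε := by
  let N : Set C(X × Y, ℝ) := {f | ∃ (a : ι → ℝ) (b : ℝ) (d : τ → ℝ) (e : ℝ), ∀ z,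
    f z = σ (a ⬝ᵥ p z.1 + b) * σ (d ⬝ᵥ q z.2 + e)}
  let W := (Submodule.span ℝ N).topologicalClosure
  have hW : IsClosed (W : Set C(X × Y, ℝ)) := Submodule.isClosed_topologicalClosure _
  let P : (ι → ℝ) → C(X × Y, ℝ) := fun a => ⟨fun z => a ⬝ᵥ p z.1, by
    simp only [dotProduct]; fun_prop⟩
  let R : (τ → ℝ) → C(X × Y, ℝ) := fun d => ⟨fun z => d ⬝ᵥ q z.2, by
    simp only [dotProduct]; fun_prop⟩
  -- Neurons are exchanged for exponentials one variable at a time: here in the first variable with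
  -- the second neuron frozen, then in the second with the exponential frozen.
  have h1 : ∀ (a : ι → ℝ) (d : τ → ℝ) (e : ℝ) (f : C(X × Y, ℝ)),
      (∀ z, f z = σ (d ⬝ᵥ q z.2 + e) * Real.exp (a ⬝ᵥ p z.1)) → f ∈ W := by
    intro a d e f hf
    refine ridge_comp_mul_mem hσ hσ' W hW (P a) ⟨fun z => σ (R d z + e), by fun_prop⟩
      (fun w b g hg => ?_) Real.continuous_exp f hf
    refine Submodule.le_topologicalClosure _ (Submodule.subset_span ⟨w • a, b, d, e, fun z => ?_⟩)
    rw [hg, smul_dotProduct, mul_comm]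
    rfl
  have h2 : ∀ (a : ι → ℝ) (d : τ → ℝ) (f : C(X × Y, ℝ)),
      (∀ z, f z = Real.exp (a ⬝ᵥ p z.1) * Real.exp (d ⬝ᵥ q z.2)) → f ∈ W := by
    intro a d f hf
    refine ridge_comp_mul_mem hσ hσ' W hW (R d) ⟨fun z => Real.exp (P a z), by fun_prop⟩
      (fun w b g hg => h1 a (w • d) b g fun z => ?_) Real.continuous_exp f hf
    rw [hg, smul_dotProduct, mul_comm]
    rfl
  have hF : F ∈ W := span_exp_dotProduct_dense hp hp' hq hq' W hW h2 F
  obtain ⟨G, hG, hFG⟩ := Metric.mem_closure_iff.1 hF ε hε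
  obtain ⟨n, c, g, rfl⟩ := Submodule.mem_span_set'.1 hG
  choose a b d e hg using fun i => (g i).2
  refine ⟨n, c, a, b, d, e, fun x y => ?_⟩
  have h3 := (ContinuousMap.dist_apply_le_dist (x, y)).trans hFG.le
  rw [Real.dist_eq, ContinuousMap.sum_apply] at h3
  simpa [hg, mul_assoc] using h3

end Density

/-! ## DeepONets built from single neurons -/

section Nets

/-- A single neuron `σ (a ⬝ u + b)`, followed by the linear output `c`. -/
def NeuralNet.neuron {κ ι : Type} (c : κ → ℝ) (a : ι → ℝ) (b : ℝ) : NeuralNet κ ι :=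
  .hidden 1 (fun _ => a) (fun _ => b) (.output (fun k _ => c k) 0)

theorem NeuralNet.eval_neuron (σ : ℝ → ℝ) {κ ι : Type} [Fintype ι] (c : κ → ℝ) (a : ι → ℝ)
    (b : ℝ) (u : ι → ℝ) (k : κ) :
    (NeuralNet.neuron c a b).eval σ u k = c k * σ (a ⬝ᵥ u + b) := by
  simp [NeuralNet.neuron, NeuralNet.eval, Matrix.mulVec, dotProduct]

/-- DeepONets compute, in each component, finite sums of products of two neurons. -/
theorem exists_deepONet_eval_eq (σ : ℝ → ℝ) {ι τ κ : Type} [Fintype ι] [Fintype τ] [Fintype κ]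
    [DecidableEq κ] (n : κ → ℕ) (c : ∀ k, Fin (n k) → ℝ) (a : ∀ k, Fin (n k) → ι → ℝ)
    (b : ∀ k, Fin (n k) → ℝ) (d : ∀ k, Fin (n k) → τ → ℝ) (e : ∀ k, Fin (n k) → ℝ) :
    ∃ G : DeepONet ι τ κ, ∀ u y k, G.eval σ u y k =
      ∑ i, c k i * σ (a k i ⬝ᵥ u + b k i) * σ (d k i ⬝ᵥ y + e k i) := by
  -- One branch and trunk pair for each component and summand; the trunk is nonzero only in its own
  -- component.
  let E := Fintype.equivFin (Σ k, Fin (n k))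
  refine ⟨⟨_, fun i => .neuron (fun _ => c _ (E.symm i).2) (a _ (E.symm i).2) (b _ (E.symm i).2),
    fun i => .neuron (Pi.single (E.symm i).1 1) (d _ (E.symm i).2) (e _ (E.symm i).2)⟩,
    fun u y k => ?_⟩
  simp only [DeepONet.eval, Finset.sum_apply, Pi.smul_apply, NeuralNet.eval_neuron, smul_eq_mul]
  rw [E.symm.sum_comp fun s : Σ k, Fin (n k) => c s.1 s.2 * σ (a s.1 s.2 ⬝ᵥ u + b s.1 s.2) *
    ((Pi.single s.1 1 : κ → ℝ) k * σ (d s.1 s.2 ⬝ᵥ y + e s.1 s.2)), Fintype.sum_sigma,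
    Finset.sum_eq_single k]
  · simp
  · intro k' _ hk
    simp [Pi.single_eq_of_ne hk.symm]
  · simp

end Nets

/-! ## The kernel equations as a fixed point problem -/

section Triangle

open MeasureTheory

theorem retraction_mem_triangle (p : ℝ × ℝ) :
    (max 0 (min p.1 1), max 0 (min p.2 (max 0 (min p.1 1)))) ∈ triangle := by
  refine ⟨le_max_left _ _, ?_, ?_⟩
  · exact max_le (le_max_left _ _) (min_le_right _ _)
  · exact max_le zero_le_one (min_le_right _ _)

/-- A continuous retraction of the plane onto the triangle. -/
def triangleRetraction (p : ℝ × ℝ) : triangle :=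
  ⟨(max 0 (min p.1 1), max 0 (min p.2 (max 0 (min p.1 1)))), retraction_mem_triangle p⟩

@[fun_prop]
theorem continuous_triangleRetraction : Continuous triangleRetraction := by
  refine Continuous.subtype_mk ?_ _
  fun_prop

theorem triangleRetraction_of_mem {p : ℝ × ℝ} (hp : p ∈ triangle) :
    triangleRetraction p = ⟨p, hp⟩ := by
  obtain ⟨h1, h2, h3⟩ := hp
  have hx : max 0 (min p.1 1) = p.1 := by rw [min_eq_left h3, max_eq_right (h1.trans h2)]
  apply Subtype.ext
  simp only [triangleRetraction, hx, min_eq_left h2, max_eq_right h1]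

theorem isCompact_triangle : IsCompact triangle := by
  refine (isCompact_Icc (a := ((0 : ℝ), (0 : ℝ))) (b := (1, 1))).of_isClosed_subset ?_ ?_
  · refine IsClosed.inter ?_ (IsClosed.inter ?_ ?_)
    · exact isClosed_le continuous_const continuous_snd
    · exact isClosed_le continuous_snd continuous_fst
    · exact isClosed_le continuous_fst continuous_const
  · rintro p ⟨h1, h2, h3⟩
    exact ⟨⟨h1.trans h2, h1⟩, ⟨h3, h2.trans h3⟩⟩

theorem mem_triangle_bottom {x : ℝ} (hx : x ∈ Set.Icc (0 : ℝ) 1) : (x, (0 : ℝ)) ∈ triangle :=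
  ⟨le_rfl, hx.1, hx.2⟩

theorem mem_Icc_of_mem_triangle {x ξ : ℝ} (h : (x, ξ) ∈ triangle) : x ∈ Set.Icc (0 : ℝ) 1 :=
  ⟨h.1.trans h.2.1, h.2.2⟩

theorem sub_mem_Icc_of_mem_triangle {x ξ : ℝ} (h : (x, ξ) ∈ triangle) :
    x - ξ ∈ Set.Icc (0 : ℝ) 1 := by
  obtain ⟨h1, h2, h3⟩ := h
  simp only at h1 h2 h3
  constructor <;> linarith

theorem add_mem_triangle {x ξ t : ℝ} (h : (x, ξ) ∈ triangle) (ht : t ∈ Set.Icc 0 ξ) :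
    (x - ξ + t, t) ∈ triangle := by
  obtain ⟨h1, h2, h3⟩ := h
  simp only at h1 h2 h3
  obtain ⟨h4, h5⟩ := ht
  refine ⟨h4, ?_, ?_⟩ <;> simp only <;> linarith

/-- Bounded measurable functions on the triangle are integrable along curves in the triangle. -/
theorem intervalIntegrable_comp_of_mem_triangle {f : ℝ → ℝ → ℝ}
    (hf : Measurable fun p : triangle => f p.1.1 p.1.2) {M : ℝ}
    (hM : ∀ x ξ, (x, ξ) ∈ triangle → |f x ξ| ≤ M) {c d : ℝ → ℝ} (hc : Continuous c)
    (hd : Continuous d) {s : ℝ} (hs : 0 ≤ s) (hT : ∀ t ∈ Set.Icc 0 s, (c t, d t) ∈ triangle) :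
    IntervalIntegrable (fun t => f (c t) (d t)) volume 0 s := by
  -- Measurability is known only on the triangle; composing with the retraction gives a measurable
  -- function on the line that agrees with `f` along the curve.
  let g : ℝ → ℝ := fun t => (fun p : triangle => f p.1.1 p.1.2) (triangleRetraction (c t, d t))
  have hg : Measurable g := hf.comp
    (continuous_triangleRetraction.comp (hc.prodMk hd)).measurable
  have hgi : IntervalIntegrable g volume 0 s := by
    rw [intervalIntegrable_iff_integrableOn_Icc_of_le hs]
    refine Measure.integrableOn_of_bounded (M := M) (by simp) hg.aestronglyMeasurable ?_
    exact Filter.Eventually.of_forall fun t => hM _ _ (triangleRetraction (c t, d t)).2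
  refine hgi.congr fun t ht => ?_
  rw [Set.uIoc_of_le hs] at ht
  have := triangleRetraction_of_mem (hT t ⟨ht.1.le, ht.2⟩)
  simp only [g, this]

/-- Integrating the exponential weight along a curve gains the factor `1 / (μ * a)`; a large rate
`μ` makes this gain the source of the contraction. -/
theorem abs_integral_sub_integral_le_exp {F G : ℝ → ℝ} {s μ a b D : ℝ} (hs : 0 ≤ s)
    (hF : IntervalIntegrable F volume 0 s) (hG : IntervalIntegrable G volume 0 s) (hμ : 0 < μ)
    (ha : 0 < a) (hD : 0 ≤ D)
    (h : ∀ t ∈ Set.Icc 0 s, |F t - G t| ≤ D * Real.exp (μ * (b + a * t))) :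
    |(∫ t in (0 : ℝ)..s, F t) - ∫ t in (0 : ℝ)..s, G t| ≤
      D * Real.exp (μ * (b + a * s)) / (μ * a) := by
  have hμa : 0 < μ * a := mul_pos hμ ha
  rw [← intervalIntegral.integral_sub hF hG, ← Real.norm_eq_abs]
  refine (intervalIntegral.norm_integral_le_of_norm_le hs
    (g := fun t => D * Real.exp (μ * (b + a * t))) ?_ ?_).trans ?_
  · exact Filter.Eventually.of_forall fun t ht => h t ⟨ht.1.le, ht.2⟩
  · exact Continuous.intervalIntegrable (by fun_prop) _ _
  · have hd : ∀ t ∈ Set.uIcc 0 s, HasDerivAt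
        (fun t => D / (μ * a) * Real.exp (μ * (b + a * t))) (D * Real.exp (μ * (b + a * t))) t := by
      intro t _
      have h1 : HasDerivAt (fun t => μ * (b + a * t)) (μ * (a * 1)) t :=
        (((hasDerivAt_id t).const_mul a).const_add b).const_mul μ
      refine (h1.exp.const_mul (D / (μ * a))).congr_deriv ?_
      field_simp
    rw [intervalIntegral.integral_eq_sub_of_hasDerivAt hd
      (Continuous.intervalIntegrable (by fun_prop) _ _)]
    have : 0 ≤ D / (μ * a) * Real.exp (μ * (b + a * 0)) := by positivity
    calc _ ≤ D / (μ * a) * Real.exp (μ * (b + a * s)) := sub_le_self _ this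
      _ = _ := by ring

end Triangle

/-! ### Geometry of the characteristics -/

namespace SystemParam

/-- The abscissa of the diagonal point on the `i`-th characteristic line through `(x, ξ)`. -/
def charBase (S : SystemParam) (i : Fin 3) (x ξ : ℝ) : ℝ :=
  (S.lam i * x + S.lamMinus * ξ) / (S.lamMinus + S.lam i)

/-- The time needed to travel from the diagonal to `(x, ξ)` along the `i`-th characteristic. -/
def charTime (S : SystemParam) (i : Fin 3) (x ξ : ℝ) : ℝ :=
  (x - ξ) / (S.lamMinus + S.lam i)

variable {S : SystemParam}

theorem charBase_add (h : S.lamMinus + S.lam i ≠ 0) (x ξ : ℝ) :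
    S.charBase i x ξ + S.lamMinus * S.charTime i x ξ = x := by
  simp only [charBase, charTime]; field_simp; ring

theorem charBase_sub (h : S.lamMinus + S.lam i ≠ 0) (x ξ : ℝ) :
    S.charBase i x ξ - S.lam i * S.charTime i x ξ = ξ := by
  simp only [charBase, charTime]; field_simp; ring

theorem charBase_shift (x ξ s : ℝ) :
    S.charBase i (x + S.lamMinus * s) (ξ - S.lam i * s) = S.charBase i x ξ := by
  simp only [charBase]; ring

theorem charTime_shift (h : S.lamMinus + S.lam i ≠ 0) (x ξ s : ℝ) :
    S.charTime i (x + S.lamMinus * s) (ξ - S.lam i * s) = S.charTime i x ξ + s := by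
  simp only [charTime]; field_simp; ring

theorem charTime_nonneg (h1 : 0 < S.lam i) (h2 : 0 < S.lamMinus) {x ξ : ℝ}
    (h : (x, ξ) ∈ triangle) : 0 ≤ S.charTime i x ξ :=
  div_nonneg (sub_mem_Icc_of_mem_triangle h).1 (add_pos h2 h1).le

/-- From the diagonal the abscissa only increases up to `x` and the ordinate only decreases down to
`ξ`. Hence diagonal data determine `K₀` on the whole triangle. -/
theorem char_mem_triangle (h1 : 0 < S.lam i) (h2 : 0 < S.lamMinus) {x ξ : ℝ}
    (h : (x, ξ) ∈ triangle) {t : ℝ} (ht : t ∈ Set.Icc 0 (S.charTime i x ξ)) :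
    (S.charBase i x ξ + S.lamMinus * t, S.charBase i x ξ - S.lam i * t) ∈ triangle := by
  have h0 : S.lamMinus + S.lam i ≠ 0 := (add_pos h2 h1).ne'
  have h3 := charBase_add h0 x ξ
  have h4 := charBase_sub h0 x ξ
  obtain ⟨ht0, ht1⟩ := ht
  have h5 := mul_le_mul_of_nonneg_left ht1 h2.le
  have h6 := mul_le_mul_of_nonneg_left ht1 h1.le
  have h7 := mul_nonneg h2.le ht0
  have h8 := mul_nonneg h1.le ht0
  obtain ⟨h9, h10, h11⟩ := h
  simp only at h9 h10 h11
  refine ⟨?_, ?_, ?_⟩ <;> simp only <;> linarith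

/-- The matrix `Σ⁺⁺ - Σ⁻⁻ I`. -/
def coupling (S : SystemParam) : Matrix (Fin 3) (Fin 3) ℝ :=
  S.sigPP - S.sigMM • (1 : Matrix (Fin 3) (Fin 3) ℝ)

end SystemParam

/-! ### Successive approximations and integrability of the source terms -/

namespace KernelTriple

/-- The source term of the equation for the `i`-th component of `K₀`. -/
def sourceK (S : SystemParam) (k : KernelTriple) (i : Fin 3) (x ξ : ℝ) : ℝ :=
  k.N x ξ * S.sigMP i + ∑ j, k.K x ξ j * S.coupling j i

/-- The source term of the equation for `N₀`. -/
def sourceN (S : SystemParam) (k : KernelTriple) (x ξ : ℝ) : ℝ :=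
  ∑ j, k.K x ξ j * S.sigPM j

/-- `Λ⁻` times the boundary value of `N₀`. -/
def bottomN (B : Fin 2 → ℝ) (S : SystemParam) (k : KernelTriple) (x : ℝ) : ℝ :=
  ∑ j, k.K x 0 j * (S.lam j * S.Q j) + ∑ j, k.γ x j * B j

/-- The right-hand side of the equation for the `j`-th component of `γ`. -/
def sourceγ (A : Matrix (Fin 2) (Fin 2) ℝ) (C : Matrix (Fin 3) (Fin 2) ℝ) (S : SystemParam)
    (k : KernelTriple) (j : Fin 2) (x : ℝ) : ℝ :=
  ∑ i, k.γ x i * A i j - k.γ x j * S.sigMM - ∑ i, k.K x 0 i * (S.lam i * C i j)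

/-- One step of the successive approximations of the kernels along the characteristics. -/
def picard (A : Matrix (Fin 2) (Fin 2) ℝ) (B : Fin 2 → ℝ) (C : Matrix (Fin 3) (Fin 2) ℝ)
    (Kg : Fin 2 → ℝ) (S : SystemParam) (k : KernelTriple) : KernelTriple where
  K x ξ i := -S.sigMP i / (S.lamMinus + S.lam i) +
    ∫ t in (0 : ℝ)..S.charTime i x ξ,
      sourceK S k i (S.charBase i x ξ + S.lamMinus * t) (S.charBase i x ξ - S.lam i * t)
  N x ξ := (bottomN B S k (x - ξ) + ∫ t in (0 : ℝ)..ξ, sourceN S k (x - ξ + t) t) / S.lamMinus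
  γ x j := Kg j + (∫ t in (0 : ℝ)..x, sourceγ A C S k j t) / S.lamMinus

section Source

variable (A : Matrix (Fin 2) (Fin 2) ℝ) (B : Fin 2 → ℝ) (C : Matrix (Fin 3) (Fin 2) ℝ)
  (S : SystemParam) (k : KernelTriple)

theorem source_K_eq (i : Fin 3) (x ξ : ℝ) :
    (k.N x ξ • S.sigMP + k.K x ξ ᵥ* (S.sigPP - S.sigMM • (1 : Matrix (Fin 3) (Fin 3) ℝ))) i =
      sourceK S k i x ξ := rfl

theorem source_N_eq (x ξ : ℝ) : k.K x ξ ⬝ᵥ S.sigPM = sourceN S k x ξ := rfl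

theorem bottom_N_eq (x : ℝ) :
    (k.K x 0 ᵥ* S.lamPlus) ⬝ᵥ S.Q + k.γ x ⬝ᵥ B = bottomN B S k x := by
  simp [bottomN, SystemParam.lamPlus, Matrix.vecMul_diagonal, dotProduct, mul_assoc]

theorem source_γ_eq (j : Fin 2) (x : ℝ) :
    (k.γ x ᵥ* A - S.sigMM • k.γ x - (k.K x 0 ᵥ* S.lamPlus) ᵥ* C) j = sourceγ A C S k j x := by
  simp [sourceγ, SystemParam.lamPlus, Matrix.vecMul, dotProduct, mul_assoc,
    mul_comm]

end Source

/-- Bounded measurable triples. -/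
structure IsRegular (k : KernelTriple) : Prop where
  measurable_K : ∀ i, Measurable fun p : triangle => k.K p.1.1 p.1.2 i
  measurable_N : Measurable fun p : triangle => k.N p.1.1 p.1.2
  measurable_γ : ∀ j, Measurable fun x : Set.Icc (0 : ℝ) 1 => k.γ x.1 j
  bounded : ∃ M : ℝ,
    (∀ x ξ, (x, ξ) ∈ triangle → (∀ i, |k.K x ξ i| ≤ M) ∧ |k.N x ξ| ≤ M) ∧
      ∀ x ∈ Set.Icc (0 : ℝ) 1, ∀ j, |k.γ x j| ≤ M

/-- Continuous triples. -/
structure IsContinuous (k : KernelTriple) : Prop where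
  continuous_K : ∀ i, Continuous fun p : ℝ × ℝ => k.K p.1 p.2 i
  continuous_N : Continuous fun p : ℝ × ℝ => k.N p.1 p.2
  continuous_γ : ∀ j, Continuous fun x => k.γ x j

theorem IsContinuous.isRegular {k : KernelTriple} (h : k.IsContinuous) : k.IsRegular where
  measurable_K i := ((h.continuous_K i).comp continuous_subtype_val).measurable
  measurable_N := (h.continuous_N.comp continuous_subtype_val).measurable
  measurable_γ j := ((h.continuous_γ j).comp continuous_subtype_val).measurable
  bounded := by
    choose MK hK using fun i =>
      isCompact_triangle.exists_bound_of_continuousOn (h.continuous_K i).continuousOn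
    obtain ⟨MN, hN⟩ := isCompact_triangle.exists_bound_of_continuousOn h.continuous_N.continuousOn
    choose Mγ hγ using fun j => (isCompact_Icc (a := (0 : ℝ)) (b := 1)).exists_bound_of_continuousOn
      (h.continuous_γ j).continuousOn
    have h1 : ∀ i, |MK i| ≤ ∑ i, |MK i| := fun i =>
      Finset.single_le_sum (f := fun i => |MK i|) (fun _ _ => abs_nonneg _) (Finset.mem_univ i)
    have h2 : ∀ i, |Mγ i| ≤ ∑ i, |Mγ i| := fun i =>
      Finset.single_le_sum (f := fun i => |Mγ i|) (fun _ _ => abs_nonneg _) (Finset.mem_univ i)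
    have h3 : 0 ≤ ∑ i, |MK i| := Finset.sum_nonneg fun _ _ => abs_nonneg _
    have h4 : 0 ≤ ∑ i, |Mγ i| := Finset.sum_nonneg fun _ _ => abs_nonneg _
    refine ⟨∑ i, |MK i| + |MN| + ∑ j, |Mγ j|, fun x ξ hx => ⟨fun i => ?_, ?_⟩, fun x hx j => ?_⟩
    · have := hK i _ hx
      rw [Real.norm_eq_abs] at this
      linarith [h1 i, le_abs_self (MK i), abs_nonneg MN]
    · have := hN _ hx
      rw [Real.norm_eq_abs] at this
      linarith [le_abs_self MN]
    · have := hγ j _ hx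
      rw [Real.norm_eq_abs] at this
      linarith [h2 j, le_abs_self (Mγ j), abs_nonneg MN]

namespace IsRegular

open MeasureTheory

variable {k : KernelTriple} (h : k.IsRegular) {c d : ℝ → ℝ} {s : ℝ}
include h

theorem intervalIntegrable_K (i : Fin 3) (hc : Continuous c) (hd : Continuous d) (hs : 0 ≤ s)
    (hT : ∀ t ∈ Set.Icc 0 s, (c t, d t) ∈ triangle) :
    IntervalIntegrable (fun t => k.K (c t) (d t) i) volume 0 s := by
  obtain ⟨M, hM, -⟩ := h.bounded
  exact intervalIntegrable_comp_of_mem_triangle (f := fun x ξ => k.K x ξ i) (h.measurable_K i)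
    (fun x ξ hx => (hM x ξ hx).1 i) hc hd hs hT

theorem intervalIntegrable_N (hc : Continuous c) (hd : Continuous d) (hs : 0 ≤ s)
    (hT : ∀ t ∈ Set.Icc 0 s, (c t, d t) ∈ triangle) :
    IntervalIntegrable (fun t => k.N (c t) (d t)) volume 0 s := by
  obtain ⟨M, hM, -⟩ := h.bounded
  exact intervalIntegrable_comp_of_mem_triangle h.measurable_N
    (fun x ξ hx => (hM x ξ hx).2) hc hd hs hT

theorem intervalIntegrable_γ (j : Fin 2) (hs : s ∈ Set.Icc (0 : ℝ) 1) :
    IntervalIntegrable (fun t => k.γ t j) volume 0 s := by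
  obtain ⟨M, -, hM⟩ := h.bounded
  have hm : Measurable fun p : triangle => k.γ p.1.1 j :=
    (h.measurable_γ j).comp (f := fun p : triangle =>
      (⟨p.1.1, mem_Icc_of_mem_triangle p.2⟩ : Set.Icc (0 : ℝ) 1)) (by fun_prop)
  exact intervalIntegrable_comp_of_mem_triangle (f := fun x _ => k.γ x j) hm
    (fun x ξ hx => hM x (mem_Icc_of_mem_triangle hx) j) continuous_id (d := fun _ => 0)
    continuous_const hs.1 fun t ht => mem_triangle_bottom ⟨ht.1, ht.2.trans hs.2⟩

theorem intervalIntegrable_sourceK (S : SystemParam) (i : Fin 3) (hc : Continuous c)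
    (hd : Continuous d) (hs : 0 ≤ s) (hT : ∀ t ∈ Set.Icc 0 s, (c t, d t) ∈ triangle) :
    IntervalIntegrable (fun t => sourceK S k i (c t) (d t)) volume 0 s := by
  simp only [sourceK, Fin.sum_univ_three]
  have hK := fun i => h.intervalIntegrable_K i hc hd hs hT
  exact ((h.intervalIntegrable_N hc hd hs hT).mul_const _).add
    ((((hK 0).mul_const _).add ((hK 1).mul_const _)).add ((hK 2).mul_const _))

theorem intervalIntegrable_sourceN (S : SystemParam) (hc : Continuous c)
    (hd : Continuous d) (hs : 0 ≤ s) (hT : ∀ t ∈ Set.Icc 0 s, (c t, d t) ∈ triangle) :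
    IntervalIntegrable (fun t => sourceN S k (c t) (d t)) volume 0 s := by
  simp only [sourceN, Fin.sum_univ_three]
  have hK := fun i => h.intervalIntegrable_K i hc hd hs hT
  exact (((hK 0).mul_const _).add ((hK 1).mul_const _)).add ((hK 2).mul_const _)

theorem intervalIntegrable_sourceγ (A : Matrix (Fin 2) (Fin 2) ℝ) (C : Matrix (Fin 3) (Fin 2) ℝ)
    (S : SystemParam) (j : Fin 2) (hs : s ∈ Set.Icc (0 : ℝ) 1) :
    IntervalIntegrable (fun t => sourceγ A C S k j t) volume 0 s := by
  simp only [sourceγ, Fin.sum_univ_three, Fin.sum_univ_two]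
  have hK := fun i => h.intervalIntegrable_K i continuous_id (d := fun _ => 0)
    continuous_const hs.1 fun t ht => mem_triangle_bottom ⟨ht.1, ht.2.trans hs.2⟩
  have hγ := fun i => h.intervalIntegrable_γ i hs
  exact ((((hγ 0).mul_const _).add ((hγ 1).mul_const _)).sub ((hγ j).mul_const _)).sub
    ((((hK 0).mul_const _).add ((hK 1).mul_const _)).add ((hK 2).mul_const _))

end IsRegular

end KernelTriple

/-! ### Equivalence of the kernel equations with the fixed point equation -/

namespace KernelTriple

open MeasureTheory

variable {A : Matrix (Fin 2) (Fin 2) ℝ} {B : Fin 2 → ℝ} {C : Matrix (Fin 3) (Fin 2) ℝ}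
  {Kg : Fin 2 → ℝ} {S : SystemParam} {k l : KernelTriple}

theorem vecMul_lamMinus_add_lamPlus (v : Fin 3 → ℝ) (i : Fin 3) :
    (v ᵥ* (S.lamMinus • (1 : Matrix (Fin 3) (Fin 3) ℝ) + S.lamPlus)) i =
      v i * (S.lamMinus + S.lam i) := by
  simp [SystemParam.lamPlus, Matrix.vecMul_add, Matrix.vecMul_smul, Matrix.vecMul_diagonal]
  ring

/-- `k` is a fixed point of the successive approximations on the triangle. -/
def IsPicardFixed (A : Matrix (Fin 2) (Fin 2) ℝ) (B : Fin 2 → ℝ) (C : Matrix (Fin 3) (Fin 2) ℝ)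
    (Kg : Fin 2 → ℝ) (S : SystemParam) (k : KernelTriple) : Prop :=
  ∀ x ξ, (x, ξ) ∈ triangle → k.value x ξ = (picard A B C Kg S k).value x ξ

theorem _root_.IsKernelSolution.isRegular (h : IsKernelSolution A B C Kg S k) : k.IsRegular :=
  ⟨h.measurable_K, h.measurable_N, h.measurable_γ, h.bounded⟩

/-- Each integrated equation is used on the full segment from the boundary point to `(x, ξ)`, with
the boundary condition inserted at its start. -/
theorem _root_.IsKernelSolution.isPicardFixed (h : IsKernelSolution A B C Kg S k)
    (hlam : ∀ i, 0 < S.lam i) (hm : 0 < S.lamMinus) : k.IsPicardFixed A B C Kg S := by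
  intro x ξ hx
  ext (i | _ | j)
  · have h0 : S.lamMinus + S.lam i ≠ 0 := (add_pos hm (hlam i)).ne'
    have hs := SystemParam.charTime_nonneg (hlam i) hm hx
    have hb : (S.charBase i x ξ, S.charBase i x ξ) ∈ triangle := by
      simpa using SystemParam.char_mem_triangle (hlam i) hm hx (t := 0) ⟨le_rfl, hs⟩
    have h1 := h.eq_K i _ _ (S.charTime i x ξ) hs hb
      (SystemParam.char_mem_triangle (hlam i) hm hx ⟨hs, le_rfl⟩)
    simp only [SystemParam.charBase_add h0, SystemParam.charBase_sub h0, source_K_eq] at h1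
    have h2 := congrFun (h.diag_K _ (mem_Icc_of_mem_triangle hb)) i
    rw [vecMul_lamMinus_add_lamPlus, Pi.neg_apply, ← eq_div_iff h0] at h2
    change k.K x ξ i = -S.sigMP i / (S.lamMinus + S.lam i) + _
    rw [← h2, ← h1]
    ring
  · have h1 := h.eq_N (x - ξ) 0 ξ hx.1 (mem_triangle_bottom (sub_mem_Icc_of_mem_triangle hx))
      (by simpa using hx)
    have h2 := h.bottom_N (x - ξ) (sub_mem_Icc_of_mem_triangle hx)
    rw [sub_eq_iff_eq_add', bottom_N_eq] at h2
    simp only [sub_add_cancel, zero_add, source_N_eq] at h1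
    change k.N x ξ = (bottomN B S k (x - ξ) + _) / S.lamMinus
    rw [eq_div_iff hm.ne', ← h1, ← h2]
    ring
  · have h1 := h.eq_γ x (mem_Icc_of_mem_triangle hx) j
    simp only [source_γ_eq, h.init_γ] at h1
    change k.γ x j = Kg j + _ / S.lamMinus
    rw [← h1]
    field_simp
    ring

theorem IsContinuous.continuous_sourceK (h : k.IsContinuous) (i : Fin 3) :
    Continuous fun p : ℝ × ℝ => sourceK S k i p.1 p.2 := by
  have h1 := h.continuous_K
  have h2 := h.continuous_N
  simp only [sourceK]
  fun_prop

theorem IsContinuous.continuous_sourceN (h : k.IsContinuous) :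
    Continuous fun p : ℝ × ℝ => sourceN S k p.1 p.2 := by
  have h1 := h.continuous_K
  simp only [sourceN]
  fun_prop

theorem integral_add_sub_integral {f : ℝ → ℝ} (hf : Continuous f) (a s : ℝ) :
    (∫ t in (0 : ℝ)..a + s, f t) - ∫ t in (0 : ℝ)..a, f t = ∫ t in (0 : ℝ)..s, f (a + t) := by
  rw [intervalIntegral.integral_interval_sub_left (hf.intervalIntegrable _ _)
    (hf.intervalIntegrable _ _), intervalIntegral.integral_comp_add_left f a, add_zero]

/-- Two points on one characteristic have the same boundary point, so the difference of their values
is the integral over the segment between them. The boundary conditions appear where the integrals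
have length zero. -/
theorem IsPicardFixed.isKernelSolution (h : k.IsPicardFixed A B C Kg S) (hk : k.IsContinuous)
    (hlam : ∀ i, 0 < S.lam i) (hm : 0 < S.lamMinus) : IsKernelSolution A B C Kg S k := by
  have hK : ∀ x ξ, (x, ξ) ∈ triangle → ∀ i, k.K x ξ i = (picard A B C Kg S k).K x ξ i :=
    fun x ξ hx i => congrFun (h x ξ hx) (.inl i)
  have hN : ∀ x ξ, (x, ξ) ∈ triangle → k.N x ξ = (picard A B C Kg S k).N x ξ :=
    fun x ξ hx => congrFun (h x ξ hx) (.inr (.inl ()))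
  have hγ : ∀ x ∈ Set.Icc (0 : ℝ) 1, ∀ j, k.γ x j = (picard A B C Kg S k).γ x j :=
    fun x hx j => congrFun (h x 0 (mem_triangle_bottom hx)) (.inr (.inr j))
  have h0 : k.γ 0 = Kg := by
    ext j
    rw [hγ 0 ⟨le_rfl, zero_le_one⟩ j]
    simp [picard]
  obtain ⟨m1, m2, m3, m4⟩ := hk.isRegular
  refine ⟨m1, m2, m3, m4, ?_, ?_, ?_, ?_, ?_, h0⟩
  · intro i x ξ s hs hx hxs
    have hne : S.lamMinus + S.lam i ≠ 0 := (add_pos hm (hlam i)).ne'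
    simp only [source_K_eq]
    rw [hK _ _ hxs, hK _ _ hx]
    simp only [picard, SystemParam.charBase_shift, SystemParam.charTime_shift hne]
    have hc : Continuous fun t => sourceK S k i (S.charBase i x ξ + S.lamMinus * t)
        (S.charBase i x ξ - S.lam i * t) :=
      (hk.continuous_sourceK i).comp (f := fun t => (S.charBase i x ξ + S.lamMinus * t,
        S.charBase i x ξ - S.lam i * t)) (by fun_prop)
    rw [add_sub_add_left_eq_sub, integral_add_sub_integral hc]
    refine intervalIntegral.integral_congr fun t _ => ?_
    have e1 := SystemParam.charBase_add hne x ξ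
    have e2 := SystemParam.charBase_sub hne x ξ
    congr 1
    · linear_combination e1
    · linear_combination e2
  · intro x ξ s hs hx hxs
    simp only [source_N_eq]
    rw [hN _ _ hxs, hN _ _ hx]
    simp only [picard, add_sub_add_right_eq_sub]
    have hc : Continuous fun t => sourceN S k (x - ξ + t) t :=
      hk.continuous_sourceN.comp (f := fun t => (x - ξ + t, t)) (by fun_prop)
    rw [← sub_div, mul_div_cancel₀ _ hm.ne', add_sub_add_left_eq_sub,
      integral_add_sub_integral hc]
    refine intervalIntegral.integral_congr fun t _ => ?_
    congr 1
    ring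
  · intro x hx
    ext i
    have hne : S.lamMinus + S.lam i ≠ 0 := (add_pos hm (hlam i)).ne'
    rw [vecMul_lamMinus_add_lamPlus, hK x x ⟨hx.1, le_rfl, hx.2⟩ i]
    simp [picard, SystemParam.charTime, hne]
  · intro x hx
    rw [sub_eq_iff_eq_add', bottom_N_eq, hN _ _ (mem_triangle_bottom hx)]
    simp [picard, mul_div_cancel₀ _ hm.ne']
  · intro x hx j
    simp only [source_γ_eq]
    rw [hγ x hx, h0]
    simp [picard, mul_div_cancel₀ _ hm.ne']

/-! ### Contraction in a weighted norm and uniqueness -/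

/-- `L` bounds the size of all coefficients of the equations. -/
structure CoeffBound (A : Matrix (Fin 2) (Fin 2) ℝ) (B : Fin 2 → ℝ) (C : Matrix (Fin 3) (Fin 2) ℝ)
    (S : SystemParam) (L : ℝ) : Prop where
  one_le : 1 ≤ L
  inv_le : S.lamMinus⁻¹ ≤ L
  sourceK_le : ∀ i, |S.sigMP i| + ∑ j, |S.coupling j i| ≤ L
  sourceN_le : ∑ j, |S.sigPM j| ≤ L
  bottomN_le : ∑ j, |S.lam j * S.Q j| + ∑ j, |B j| ≤ L
  sourceγ_le : ∀ j, ∑ i, |A i j| + |S.sigMM| + ∑ i, |S.lam i * C i j| ≤ L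

theorem abs_sum_mul_sub_le {ι : Type*} [Fintype ι] {u v : ι → ℝ} {m : ℝ}
    (h : ∀ i, |u i - v i| ≤ m) (w : ι → ℝ) :
    |∑ i, u i * w i - ∑ i, v i * w i| ≤ m * ∑ i, |w i| := by
  rw [← Finset.sum_sub_distrib, Finset.mul_sum]
  refine (Finset.abs_sum_le_sum_abs _ _).trans (Finset.sum_le_sum fun i _ => ?_)
  rw [← sub_mul, abs_mul]
  exact mul_le_mul_of_nonneg_right (h i) (abs_nonneg _)

namespace CoeffBound

variable {L : ℝ} (hL : CoeffBound A B C S L) {m m' : ℝ}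
include hL

theorem abs_sourceK_sub_le {x ξ : ℝ} (hm : 0 ≤ m) (hm' : 0 ≤ m')
    (hK : ∀ i, |k.K x ξ i - l.K x ξ i| ≤ m) (hN : |k.N x ξ - l.N x ξ| ≤ m') (i : Fin 3) :
    |sourceK S k i x ξ - sourceK S l i x ξ| ≤ L * (m + m') := by
  have h1 := abs_sum_mul_sub_le hK (fun j => S.coupling j i)
  have h2 : |k.N x ξ * S.sigMP i - l.N x ξ * S.sigMP i| ≤ m' * |S.sigMP i| := by
    rw [← sub_mul, abs_mul]
    exact mul_le_mul_of_nonneg_right hN (abs_nonneg _)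
  have h3 : 0 ≤ ∑ j, |S.coupling j i| := Finset.sum_nonneg fun _ _ => abs_nonneg _
  have h4 := abs_nonneg (S.sigMP i)
  have h5 := hL.sourceK_le i
  have h6 := mul_le_mul_of_nonneg_left h5 (add_nonneg hm hm')
  calc |sourceK S k i x ξ - sourceK S l i x ξ|
      = |(k.N x ξ * S.sigMP i - l.N x ξ * S.sigMP i) +
          (∑ j, k.K x ξ j * S.coupling j i - ∑ j, l.K x ξ j * S.coupling j i)| := by
        simp only [sourceK]; congr 1; ring
    _ ≤ m' * |S.sigMP i| + m * ∑ j, |S.coupling j i| := (abs_add_le _ _).trans (add_le_add h2 h1)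
    _ ≤ L * (m + m') := by nlinarith [mul_nonneg hm h4, mul_nonneg hm' h3]

theorem abs_sourceN_sub_le {x ξ : ℝ} (hm : 0 ≤ m) (hK : ∀ i, |k.K x ξ i - l.K x ξ i| ≤ m) :
    |sourceN S k x ξ - sourceN S l x ξ| ≤ L * m := by
  refine (abs_sum_mul_sub_le hK _).trans ?_
  rw [mul_comm]
  exact mul_le_mul_of_nonneg_right hL.sourceN_le hm

theorem abs_bottomN_sub_le {x : ℝ} (hm : 0 ≤ m) (hK : ∀ i, |k.K x 0 i - l.K x 0 i| ≤ m)
    (hγ : ∀ j, |k.γ x j - l.γ x j| ≤ m) :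
    |bottomN B S k x - bottomN B S l x| ≤ L * m := by
  have h1 := abs_sum_mul_sub_le hK (fun j => S.lam j * S.Q j)
  have h2 := abs_sum_mul_sub_le hγ B
  calc |bottomN B S k x - bottomN B S l x|
      = |(∑ j, k.K x 0 j * (S.lam j * S.Q j) - ∑ j, l.K x 0 j * (S.lam j * S.Q j)) +
          (∑ j, k.γ x j * B j - ∑ j, l.γ x j * B j)| := by
        simp only [bottomN]; congr 1; ring
    _ ≤ m * ∑ j, |S.lam j * S.Q j| + m * ∑ j, |B j| :=
        (abs_add_le _ _).trans (add_le_add h1 h2)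
    _ = (∑ j, |S.lam j * S.Q j| + ∑ j, |B j|) * m := by ring
    _ ≤ L * m := mul_le_mul_of_nonneg_right hL.bottomN_le hm

theorem abs_sourceγ_sub_le {x : ℝ} (hm : 0 ≤ m) (hK : ∀ i, |k.K x 0 i - l.K x 0 i| ≤ m)
    (hγ : ∀ j, |k.γ x j - l.γ x j| ≤ m) (j : Fin 2) :
    |sourceγ A C S k j x - sourceγ A C S l j x| ≤ L * m := by
  have h1 := abs_sum_mul_sub_le hK (fun i => S.lam i * C i j)
  have h2 := abs_sum_mul_sub_le hγ (fun i => A i j)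
  have h3 : |k.γ x j * S.sigMM - l.γ x j * S.sigMM| ≤ m * |S.sigMM| := by
    rw [← sub_mul, abs_mul]
    exact mul_le_mul_of_nonneg_right (hγ j) (abs_nonneg _)
  calc |sourceγ A C S k j x - sourceγ A C S l j x|
      = |(∑ i, k.γ x i * A i j - ∑ i, l.γ x i * A i j) -
          (k.γ x j * S.sigMM - l.γ x j * S.sigMM) -
          (∑ i, k.K x 0 i * (S.lam i * C i j) - ∑ i, l.K x 0 i * (S.lam i * C i j))| := by
        simp only [sourceγ]; congr 1; ring
    _ ≤ m * ∑ i, |A i j| + m * |S.sigMM| + m * ∑ i, |S.lam i * C i j| :=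
        (abs_sub _ _).trans (add_le_add ((abs_sub _ _).trans (add_le_add h2 h3)) h1)
    _ = (∑ i, |A i j| + |S.sigMM| + ∑ i, |S.lam i * C i j|) * m := by ring
    _ ≤ L * m := mul_le_mul_of_nonneg_right (hL.sourceγ_le j) hm

end CoeffBound

/-- The weights of the components of `(K₀, N₀, γ)`. -/
def weight (L : ℝ) : Idx → ℝ :=
  -- The boundary term of `N₀` is not integrated, so the exponential gives it no gain. The error in
  -- `N₀` after one step is at most `2 * L ^ 2` times the error in `K₀` and `γ`, and the weight `4 *
  -- L ^ 2` turns this into a factor one half.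
  Sum.elim (fun _ => 1) (Sum.elim (fun _ => 4 * L ^ 2) fun _ => 1)

/-- The exponential growth rate in the weighted norm. -/
def rate (L : ℝ) : ℝ := 2 * L ^ 2 * (4 * L ^ 2 + 1)

/-- The weighted distance of `k` and `l` is at most `m`. -/
def Near (L m : ℝ) (k l : KernelTriple) : Prop :=
  ∀ x ξ, (x, ξ) ∈ triangle → ∀ κ,
    |k.value x ξ κ - l.value x ξ κ| ≤ m * Real.exp (rate L * x) * weight L κ

theorem one_le_weight {L : ℝ} (hL : 1 ≤ L) (κ : Idx) : 1 ≤ weight L κ := by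
  rcases κ with (i | _ | j)
  · exact le_rfl
  · change 1 ≤ 4 * L ^ 2
    nlinarith
  · exact le_rfl

/-- The successive approximations halve the weighted distance. -/
theorem Near.picard {L m : ℝ} (h : Near L m k l) (hL : CoeffBound A B C S L) (hm : 0 ≤ m)
    (hlam : ∀ i, 0 < S.lam i) (hΛ : 0 < S.lamMinus) (hk : k.IsRegular) (hl : l.IsRegular) :
    Near L (m / 2) (picard A B C Kg S k) (picard A B C Kg S l) := by
  have hL1 := hL.one_le
  have hL0 : 0 < L := by linarith
  have hμ : 0 < rate L := by unfold rate; positivity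
  have hinv := hL.inv_le
  have hK : ∀ x ξ, (x, ξ) ∈ triangle → ∀ i, |k.K x ξ i - l.K x ξ i| ≤ m * Real.exp (rate L * x) :=
    fun x ξ hx i => by simpa [value, weight] using h x ξ hx (.inl i)
  have hN : ∀ x ξ, (x, ξ) ∈ triangle →
      |k.N x ξ - l.N x ξ| ≤ m * Real.exp (rate L * x) * (4 * L ^ 2) :=
    fun x ξ hx => by simpa [value, weight] using h x ξ hx (.inr (.inl ()))
  have hγ : ∀ x ∈ Set.Icc (0 : ℝ) 1, ∀ j, |k.γ x j - l.γ x j| ≤ m * Real.exp (rate L * x) :=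
    fun x hx j => by simpa [value, weight] using h x 0 (mem_triangle_bottom hx) (.inr (.inr j))
  intro x ξ hx κ
  have hE : 0 < Real.exp (rate L * x) := Real.exp_pos _
  have hmE : 0 ≤ m * Real.exp (rate L * x) := by positivity
  rcases κ with (i | _ | j)
  · have h0 : S.lamMinus + S.lam i ≠ 0 := (add_pos hΛ (hlam i)).ne'
    have hs := SystemParam.charTime_nonneg (hlam i) hΛ hx
    have hT := fun t ht => SystemParam.char_mem_triangle (hlam i) hΛ hx (t := t) ht
    have hi := fun (k : KernelTriple) (hk : k.IsRegular) => hk.intervalIntegrable_sourceK S i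
      (c := fun t => S.charBase i x ξ + S.lamMinus * t)
      (d := fun t => S.charBase i x ξ - S.lam i * t) (by fun_prop) (by fun_prop) hs hT
    have h1 := abs_integral_sub_integral_le_exp (D := L * (m + m * (4 * L ^ 2))) hs (hi k hk)
      (hi l hl) hμ hΛ (by positivity) fun t ht => by
        refine (hL.abs_sourceK_sub_le (by positivity) (by positivity) (hK _ _ (hT t ht))
          (hN _ _ (hT t ht)) i).trans (le_of_eq ?_)
        ring
    rw [SystemParam.charBase_add h0] at h1
    have h2 : L * (m + m * (4 * L ^ 2)) * Real.exp (rate L * x) / (rate L * S.lamMinus) ≤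
        m / 2 * Real.exp (rate L * x) := by
      have e : L * (m + m * (4 * L ^ 2)) * Real.exp (rate L * x) / (rate L * S.lamMinus) =
          m * Real.exp (rate L * x) / (2 * L) * S.lamMinus⁻¹ := by
        unfold rate; field_simp; ring
      rw [e]
      calc _ ≤ m * Real.exp (rate L * x) / (2 * L) * L := by gcongr
        _ = _ := by field_simp
    simpa [value, KernelTriple.picard, weight] using h1.trans h2
  · have hb := sub_mem_Icc_of_mem_triangle hx
    have h1 := hL.abs_bottomN_sub_le (m := m * Real.exp (rate L * (x - ξ))) (by positivity)
      (hK _ _ (mem_triangle_bottom hb)) (hγ _ hb)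
    have hle : Real.exp (rate L * (x - ξ)) ≤ Real.exp (rate L * x) :=
      Real.exp_le_exp.2 (mul_le_mul_of_nonneg_left (sub_le_self _ hx.1) hμ.le)
    have hT := fun t ht => add_mem_triangle hx (t := t) ht
    have hi := fun (k : KernelTriple) (hk : k.IsRegular) => hk.intervalIntegrable_sourceN S
      (c := fun t => x - ξ + t) (d := fun t => t) (by fun_prop) (by fun_prop) hx.1 hT
    have h2 := abs_integral_sub_integral_le_exp (D := L * m) (b := x - ξ) hx.1 (hi k hk)
      (hi l hl) hμ one_pos (by positivity) fun t ht => by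
        refine (hL.abs_sourceN_sub_le (by positivity) (hK _ _ (hT t ht))).trans (le_of_eq ?_)
        rw [one_mul]
        ring
    rw [one_mul, sub_add_cancel, mul_one] at h2
    have hμ1 : 1 ≤ rate L := by unfold rate; nlinarith
    have h3 : L * m * Real.exp (rate L * x) / rate L ≤ L * (m * Real.exp (rate L * x)) := by
      rw [mul_assoc]
      exact div_le_self (by positivity) hμ1
    have h4 : L * (m * Real.exp (rate L * (x - ξ))) ≤ L * (m * Real.exp (rate L * x)) := by gcongr
    have h5 : ∀ a b c d : ℝ, (a + b) / S.lamMinus - (c + d) / S.lamMinus =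
      S.lamMinus⁻¹ * ((a - c) + (b - d)) := fun a b c d => by field_simp; ring
    simp only [value, KernelTriple.picard, weight, Sum.elim_inr, Sum.elim_inl, h5]
    rw [abs_mul, abs_of_pos (inv_pos.2 hΛ)]
    calc _ ≤ L * (L * (m * Real.exp (rate L * x)) + L * (m * Real.exp (rate L * x))) :=
          mul_le_mul hinv ((abs_add_le _ _).trans (add_le_add (h1.trans h4) (h2.trans h3)))
            (abs_nonneg _) hL0.le
      _ = _ := by ring
  · have hx1 := mem_Icc_of_mem_triangle hx
    have hi := fun (k : KernelTriple) (hk : k.IsRegular) =>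
      hk.intervalIntegrable_sourceγ A C S j hx1
    have h2 := abs_integral_sub_integral_le_exp (D := L * m) (b := 0) hx1.1 (hi k hk)
      (hi l hl) hμ one_pos (by positivity) fun t ht => by
        have ht' : t ∈ Set.Icc (0 : ℝ) 1 := ⟨ht.1, ht.2.trans hx1.2⟩
        refine (hL.abs_sourceγ_sub_le (by positivity) (hK _ _ (mem_triangle_bottom ht'))
          (hγ _ ht') j).trans (le_of_eq ?_)
        rw [one_mul, zero_add]
        ring
    rw [one_mul, zero_add, mul_one] at h2
    have h5 : ∀ a b c : ℝ, (c + a / S.lamMinus) - (c + b / S.lamMinus) =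
      S.lamMinus⁻¹ * (a - b) := fun a b c => by field_simp; ring
    simp only [value, KernelTriple.picard, weight, Sum.elim_inr, h5]
    rw [abs_mul, abs_of_pos (inv_pos.2 hΛ), mul_one]
    have hμ2 : 2 * L ^ 2 ≤ rate L := by unfold rate; nlinarith [sq_nonneg L, sq_nonneg (L ^ 2)]
    calc _ ≤ L * (L * m * Real.exp (rate L * x) / rate L) :=
          mul_le_mul hinv h2 (abs_nonneg _) hL0.le
      _ ≤ L * (L * m * Real.exp (rate L * x) / (2 * L ^ 2)) := by gcongr
      _ = _ := by field_simp

/-- A regular fixed point of the successive approximations is unique. -/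
theorem IsPicardFixed.eqOnDomain {L : ℝ} (h : k.IsPicardFixed A B C Kg S)
    (h' : l.IsPicardFixed A B C Kg S) (hL : CoeffBound A B C S L)
    (hlam : ∀ i, 0 < S.lam i) (hΛ : 0 < S.lamMinus) (hk : k.IsRegular) (hl : l.IsRegular) :
    k.EqOnDomain l := by
  obtain ⟨M, hM, hMγ⟩ := hk.bounded
  obtain ⟨M', hM', hMγ'⟩ := hl.bounded
  have hval : ∀ x ξ, (x, ξ) ∈ triangle → ∀ κ, |k.value x ξ κ - l.value x ξ κ| ≤ |M| + |M'| := by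
    intro x ξ hx κ
    refine (abs_sub _ _).trans (add_le_add (le_trans ?_ (le_abs_self M))
      (le_trans ?_ (le_abs_self M')))
    · rcases κ with (i | _ | j)
      exacts [(hM x ξ hx).1 i, (hM x ξ hx).2, hMγ x (mem_Icc_of_mem_triangle hx) j]
    · rcases κ with (i | _ | j)
      exacts [(hM' x ξ hx).1 i, (hM' x ξ hx).2, hMγ' x (mem_Icc_of_mem_triangle hx) j]
  -- Both triples are fixed, so their distance, finite by boundedness, can be halved indefinitely.
  have hnear : ∀ n : ℕ, Near L ((|M| + |M'|) / 2 ^ n) k l := by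
    intro n
    induction n with
    | zero =>
      intro x ξ hx κ
      have h1 : 1 ≤ Real.exp (rate L * x) := Real.one_le_exp <| by
        have := (mem_Icc_of_mem_triangle hx).1
        unfold rate
        positivity
      have h2 := one_le_weight hL.one_le κ
      have h3 : 0 ≤ |M| + |M'| := by positivity
      rw [pow_zero, div_one]
      calc _ ≤ |M| + |M'| := hval x ξ hx κ
        _ ≤ (|M| + |M'|) * Real.exp (rate L * x) := le_mul_of_one_le_right h3 h1
        _ ≤ _ := le_mul_of_one_le_right (by positivity) h2
    | succ n ih =>
      intro x ξ hx κ
      have := ih.picard (Kg := Kg) hL (by positivity) hlam hΛ hk hl x ξ hx κ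
      rw [← h x ξ hx, ← h' x ξ hx, div_div, ← pow_succ] at this
      exact this
  have heq : ∀ x ξ, (x, ξ) ∈ triangle → ∀ κ, k.value x ξ κ = l.value x ξ κ := by
    intro x ξ hx κ
    have hlim : Filter.Tendsto (fun n : ℕ => (|M| + |M'|) / 2 ^ n * Real.exp (rate L * x) *
        weight L κ) Filter.atTop (nhds 0) := by
      have h1 : Filter.Tendsto (fun n : ℕ => ((1 : ℝ) / 2) ^ n) Filter.atTop (nhds 0) :=
        tendsto_pow_atTop_nhds_zero_of_lt_one (by norm_num) (by norm_num)
      have h2 := ((h1.const_mul (|M| + |M'|)).mul_const (Real.exp (rate L * x))).mul_const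
        (weight L κ)
      simpa [div_eq_mul_inv] using h2
    have := ge_of_tendsto' hlim fun n => hnear n x ξ hx κ
    exact sub_eq_zero.1 (abs_nonpos_iff.1 this)
  refine ⟨fun x ξ hx => ⟨funext fun i => heq x ξ hx (.inl i), heq x ξ hx (.inr (.inl ()))⟩,
    fun x hx => funext fun j => heq x 0 (mem_triangle_bottom hx) (.inr (.inr j))⟩

end KernelTriple

/-! ### The scalar coordinates embed the parameter space continuously -/

namespace SystemParam

@[fun_prop]
theorem continuous_lam : Continuous lam := continuous_fst

@[fun_prop]
theorem continuous_lamMinus : Continuous lamMinus := by unfold lamMinus; fun_prop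

@[fun_prop]
theorem continuous_sigMM : Continuous sigMM := by unfold sigMM; fun_prop

@[fun_prop]
theorem continuous_sigPP : Continuous sigPP := by unfold sigPP; fun_prop

@[fun_prop]
theorem continuous_sigPM : Continuous sigPM := by unfold sigPM; fun_prop

@[fun_prop]
theorem continuous_Q : Continuous Q := by unfold Q; fun_prop

@[fun_prop]
theorem continuous_sigMP : Continuous sigMP := by unfold sigMP; fun_prop

@[fun_prop]
theorem continuous_R : Continuous R := by unfold R; fun_prop

@[fun_prop]
theorem continuous_coupling : Continuous coupling := by unfold coupling; fun_prop

theorem continuous_coords : Continuous coords := by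
  refine continuous_pi fun i => ?_
  rcases i with (i | i | i | (i | i) | (i | i)) <;> simp only [coords, Sum.elim_inl, Sum.elim_inr]
  · fun_prop
  · fin_cases i
    · exact continuous_lamMinus
    · exact continuous_sigMM
  all_goals fun_prop

theorem coords_injective : Function.Injective coords := by
  intro S T h
  have h1 : S.lam = T.lam := funext fun i => congrFun h (.inl i)
  have h2 : S.lamMinus = T.lamMinus := congrFun h (.inr (.inl 0))
  have h3 : S.sigMM = T.sigMM := congrFun h (.inr (.inl 1))
  have h4 : S.sigPP = T.sigPP :=
    Matrix.ext fun i j => congrFun h (.inr (.inr (.inl (i, j))))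
  have h5 : S.sigPM = T.sigPM := funext fun i => congrFun h (.inr (.inr (.inr (.inl (.inl i)))))
  have h6 : S.Q = T.Q := funext fun i => congrFun h (.inr (.inr (.inr (.inl (.inr i)))))
  have h7 : S.sigMP = T.sigMP := funext fun i => congrFun h (.inr (.inr (.inr (.inr (.inl i)))))
  have h8 : S.R = T.R := funext fun i => congrFun h (.inr (.inr (.inr (.inr (.inr i)))))
  exact Prod.ext h1 (Prod.ext (Prod.ext h2 h3) (Prod.ext h4
    (Prod.ext (Prod.ext h5 h6) (Prod.ext h7 h8))))

end SystemParam

/-! ### Existence, simultaneously for all parameters -/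

namespace KernelTriple

open SystemParam

/-- The sum of all coefficient sizes, including `1 / Λ⁻`, is continuous on the compact set `Ω`; its
bound dominates each nonnegative summand. -/
theorem exists_coeffBound (A : Matrix (Fin 2) (Fin 2) ℝ) (B : Fin 2 → ℝ)
    (C : Matrix (Fin 3) (Fin 2) ℝ) {Ω : Set SystemParam} (hΩ : IsCompact Ω)
    (hpos : ∀ S ∈ Ω, 0 < S.lamMinus) : ∃ L, ∀ S ∈ Ω, CoeffBound A B C S L := by
  have hc : ContinuousOn (fun S : SystemParam => S.lamMinus⁻¹ +
      ∑ i, (|S.sigMP i| + ∑ j, |S.coupling j i|) + ∑ j, |S.sigPM j| +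
      (∑ j, |S.lam j * S.Q j| + ∑ j, |B j|) +
      ∑ j, (∑ i, |A i j| + |S.sigMM| + ∑ i, |S.lam i * C i j|)) Ω := by
    have h1 : ContinuousOn (fun S : SystemParam => S.lamMinus⁻¹) Ω :=
      continuous_lamMinus.continuousOn.inv₀ fun S hS => (hpos S hS).ne'
    fun_prop
  obtain ⟨M, hM⟩ := hΩ.exists_bound_of_continuousOn hc
  refine ⟨max 1 M, fun S hS => ?_⟩
  have h0 := (le_abs_self _).trans (hM S hS)
  have h1 : 0 < S.lamMinus⁻¹ := inv_pos.2 (hpos S hS)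
  have h2 : ∀ i, 0 ≤ |S.sigMP i| + ∑ j, |S.coupling j i| := fun i => by positivity
  have h3 : 0 ≤ ∑ j, |S.sigPM j| := by positivity
  have h4 : 0 ≤ ∑ j, |S.lam j * S.Q j| + ∑ j, |B j| := by positivity
  have h5 : ∀ j, 0 ≤ ∑ i, |A i j| + |S.sigMM| + ∑ i, |S.lam i * C i j| := fun j => by positivity
  have h6 := fun i => Finset.single_le_sum (fun i _ => h2 i) (Finset.mem_univ i)
  have h7 := fun i => Finset.single_le_sum (fun i _ => h5 i) (Finset.mem_univ i)
  have h8 := Finset.sum_nonneg fun i (_ : i ∈ Finset.univ) => h2 i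
  have h9 := Finset.sum_nonneg fun i (_ : i ∈ Finset.univ) => h5 i
  have hmax := le_max_right 1 M
  refine ⟨le_max_left _ _, ?_, fun i => ?_, ?_, ?_, fun j => ?_⟩
  · linarith
  · linarith [h6 i]
  · linarith
  · linarith
  · linarith [h7 j]

section Existence

variable {Ω : Set SystemParam}

/-- The triple of kernels at the parameter `S` given by a function on `Ω` times the triangle. -/
def ofFun (U : C(Ω × triangle, Idx → ℝ)) (S : Ω) : KernelTriple where
  K x ξ i := U (S, triangleRetraction (x, ξ)) (.inl i)
  N x ξ := U (S, triangleRetraction (x, ξ)) (.inr (.inl ()))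
  -- Components of `U` may depend on `ξ`; `γ` is read off on the bottom edge.
  γ x j := U (S, triangleRetraction (x, 0)) (.inr (.inr j))

variable (U : C(Ω × triangle, Idx → ℝ))

theorem isContinuous_ofFun (S : Ω) : (ofFun U S).IsContinuous where
  continuous_K i := by simp only [ofFun]; fun_prop
  continuous_N := by simp only [ofFun]; fun_prop
  continuous_γ j := by simp only [ofFun]; fun_prop

section Continuity

variable {Z : Type*} [TopologicalSpace Z] {s : Z → Ω} {c d : Z → ℝ}

@[fun_prop]
theorem continuous_ofFun_K (i : Fin 3) (hs : Continuous s) (hc : Continuous c)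
    (hd : Continuous d) : Continuous fun z => (ofFun U (s z)).K (c z) (d z) i := by
  simp only [ofFun]; fun_prop

@[fun_prop]
theorem continuous_ofFun_N (hs : Continuous s) (hc : Continuous c)
    (hd : Continuous d) : Continuous fun z => (ofFun U (s z)).N (c z) (d z) := by
  simp only [ofFun]; fun_prop

@[fun_prop]
theorem continuous_ofFun_γ (j : Fin 2) (hs : Continuous s) (hc : Continuous c) :
    Continuous fun z => (ofFun U (s z)).γ (c z) j := by
  simp only [ofFun]; fun_prop

end Continuity

variable (A : Matrix (Fin 2) (Fin 2) ℝ) (B : Fin 2 → ℝ) (C : Matrix (Fin 3) (Fin 2) ℝ)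
  (Kg : Fin 2 → ℝ)

/-- Base points, travel times and coefficients depend continuously on the parameter. This makes
`picard` a self-map of the continuous functions on `Ω × triangle`. -/
theorem continuous_picard_ofFun (hlam : ∀ S ∈ Ω, ∀ i, 0 < S.lam i)
    (hΛ : ∀ S ∈ Ω, 0 < S.lamMinus) : Continuous fun z : Ω × triangle =>
      (picard A B C Kg z.1 (ofFun U z.1)).value z.2.1.1 z.2.1.2 := by
  have h0 : ∀ z : Ω × triangle, z.1.1.lamMinus ≠ 0 := fun z => (hΛ _ z.1.2).ne'
  have h1 : ∀ (z : Ω × triangle) i, z.1.1.lamMinus + z.1.1.lam i ≠ 0 := fun z i =>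
    (add_pos (hΛ _ z.1.2) (hlam _ z.1.2 i)).ne'
  refine continuous_pi fun κ => ?_
  rcases κ with (i | _ | j)
  · have ht : Continuous fun z : Ω × triangle => z.1.1.charTime i z.2.1.1 z.2.1.2 := by
      unfold charTime
      exact Continuous.div (by fun_prop) (by fun_prop) fun z => h1 z i
    have hb : Continuous fun z : Ω × triangle => z.1.1.charBase i z.2.1.1 z.2.1.2 := by
      unfold charBase
      exact Continuous.div (by fun_prop) (by fun_prop) fun z => h1 z i
    simp only [value, picard, Sum.elim_inl]
    refine Continuous.add (Continuous.div (by fun_prop) (by fun_prop) fun z => h1 z i) ?_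
    refine intervalIntegral.continuous_parametric_intervalIntegral_of_continuous ?_ ht
    have hb' := hb.comp (continuous_fst (X := Ω × triangle) (Y := ℝ))
    have hc : Continuous fun p : (Ω × triangle) × ℝ =>
        p.1.1.1.charBase i p.1.2.1.1 p.1.2.1.2 + p.1.1.1.lamMinus * p.2 :=
      hb'.add (by fun_prop)
    have hd : Continuous fun p : (Ω × triangle) × ℝ =>
        p.1.1.1.charBase i p.1.2.1.1 p.1.2.1.2 - p.1.1.1.lam i * p.2 :=
      hb'.sub (by fun_prop)
    have hs : Continuous fun p : (Ω × triangle) × ℝ => p.1.1 := by fun_prop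
    exact ((continuous_ofFun_N U hs hc hd).mul (by fun_prop)).add
      (continuous_finsetSum _ fun j _ => (continuous_ofFun_K U j hs hc hd).mul (by fun_prop))
  · simp only [value, picard, Sum.elim_inl, Sum.elim_inr]
    refine Continuous.div (Continuous.add ?_ ?_) (by fun_prop) h0
    · simp only [bottomN]
      fun_prop
    · refine intervalIntegral.continuous_parametric_intervalIntegral_of_continuous ?_ (by fun_prop)
      simp only [Function.uncurry_def, sourceN]
      fun_prop
  · simp only [value, picard, Sum.elim_inr]
    refine continuous_const.add (Continuous.div ?_ (by fun_prop) h0)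
    refine intervalIntegral.continuous_parametric_intervalIntegral_of_continuous ?_ (by fun_prop)
    simp only [Function.uncurry_def, sourceγ]
    fun_prop

theorem value_ofFun_of_eq {k : Ω → KernelTriple}
    (h : ∀ z : Ω × triangle, U z = (k z.1).value z.2.1.1 z.2.1.2) (S : Ω) {x ξ : ℝ}
    (hx : (x, ξ) ∈ triangle) : (ofFun U S).value x ξ = (k S).value x ξ := by
  ext (i | _ | j)
  · simp [value, ofFun, triangleRetraction_of_mem hx, h]
  · simp [value, ofFun, triangleRetraction_of_mem hx, h]
  · have := mem_triangle_bottom (mem_Icc_of_mem_triangle hx)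
    simp [value, ofFun, triangleRetraction_of_mem this, h]

variable {A B C} in
-- Banach's theorem with the parameter as an additional variable: continuity of the solution in the
-- parameter is built into the function space.
theorem exists_fixed_ofFun (hΩ : IsCompact Ω) {L : ℝ} (hL : ∀ S ∈ Ω, CoeffBound A B C S L)
    (hlam : ∀ S ∈ Ω, ∀ i, 0 < S.lam i) (hΛ : ∀ S ∈ Ω, 0 < S.lamMinus) :
    ∃ U : C(Ω × triangle, Idx → ℝ), ∀ S : Ω, (ofFun U S).IsPicardFixed A B C Kg S := by
  have : CompactSpace Ω := isCompact_iff_compactSpace.1 hΩ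
  have : CompactSpace triangle := isCompact_iff_compactSpace.1 isCompact_triangle
  let Ψ : C(Ω × triangle, Idx → ℝ) → C(Ω × triangle, Idx → ℝ) := fun U =>
    ⟨_, continuous_picard_ofFun U A B C Kg hlam hΛ⟩
  have hΨ : ∀ U (z : Ω × triangle),
      Ψ U z = (picard A B C Kg z.1 (ofFun U z.1)).value z.2.1.1 z.2.1.2 := fun _ _ => rfl
  have hiter : ∀ (n : ℕ) (U V : C(Ω × triangle, Idx → ℝ)) (z : Ω × triangle) (κ : Idx),
      |(Ψ^[n] U) z κ - (Ψ^[n] V) z κ| ≤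
        dist U V / 2 ^ n * Real.exp (rate L * z.2.1.1) * weight L κ := by
    intro n U V
    induction n with
    | zero =>
      intro z κ
      have hL1 := (hL _ z.1.2).one_le
      have h1 : 1 ≤ Real.exp (rate L * z.2.1.1) := Real.one_le_exp <| by
        have := (mem_Icc_of_mem_triangle z.2.2).1
        unfold rate
        positivity
      have h2 := one_le_weight hL1 κ
      have h3 : |U z κ - V z κ| ≤ dist U V := by
        rw [← Real.dist_eq]
        exact (dist_le_pi_dist _ _ κ).trans (ContinuousMap.dist_apply_le_dist z)
      simp only [Function.iterate_zero, id, pow_zero, div_one]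
      calc _ ≤ dist U V := h3
        _ ≤ dist U V * Real.exp (rate L * z.2.1.1) := le_mul_of_one_le_right dist_nonneg h1
        _ ≤ _ := le_mul_of_one_le_right (by positivity) h2
    | succ n ih =>
      intro z κ
      have hnear : Near L (dist U V / 2 ^ n) (ofFun (Ψ^[n] U) z.1) (ofFun (Ψ^[n] V) z.1) := by
        intro x ξ hx κ
        rcases κ with (i | _ | j)
        · simpa [value, ofFun, triangleRetraction_of_mem hx] using ih (z.1, ⟨_, hx⟩) (.inl i)
        · simpa [value, ofFun, triangleRetraction_of_mem hx] using
            ih (z.1, ⟨_, hx⟩) (.inr (.inl ()))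
        · have hx0 := mem_triangle_bottom (mem_Icc_of_mem_triangle hx)
          simpa [value, ofFun, triangleRetraction_of_mem hx0] using
            ih (z.1, ⟨_, hx0⟩) (.inr (.inr j))
      have := hnear.picard (Kg := Kg) (hL _ z.1.2) (by positivity) (hlam _ z.1.2) (hΛ _ z.1.2)
        (isContinuous_ofFun _ _).isRegular (isContinuous_ofFun _ _).isRegular _ _ z.2.2 κ
      rw [Function.iterate_succ_apply', Function.iterate_succ_apply', hΨ, hΨ, pow_succ, ← div_div]
      exact this
  -- The halving holds in the weighted norm; enough iterations absorb the constant comparing it with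
  -- the sup norm. The fixed point of the iterate is then one of `Ψ` itself.
  obtain ⟨n, hn⟩ := pow_unbounded_of_one_lt (2 * (Real.exp (rate L) * (4 * L ^ 2))) one_lt_two
  have hcontr : ContractingWith (1 / 2) Ψ^[n] := by
    refine ⟨by rw [← NNReal.coe_lt_coe]; norm_num, LipschitzWith.of_dist_le_mul fun U V => ?_⟩
    have hd : 0 ≤ dist U V := dist_nonneg
    refine (ContinuousMap.dist_le (by positivity)).2 fun z =>
      (dist_pi_le_iff (by positivity)).2 fun κ => ?_
    have hL1 := (hL _ z.1.2).one_le
    have hr : 0 ≤ rate L := by unfold rate; positivity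
    have h1 : Real.exp (rate L * z.2.1.1) ≤ Real.exp (rate L) :=
      Real.exp_le_exp.2 (mul_le_of_le_one_right hr z.2.2.2.2)
    have h2 : weight L κ ≤ 4 * L ^ 2 := by
      rcases κ with (i | _ | j)
      · change 1 ≤ 4 * L ^ 2
        nlinarith
      · exact le_rfl
      · change 1 ≤ 4 * L ^ 2
        nlinarith
    have h0 := one_le_weight hL1 κ
    rw [Real.dist_eq]
    have h3 : (0 : ℝ) < 2 ^ n := by positivity
    calc _ ≤ dist U V / 2 ^ n * Real.exp (rate L * z.2.1.1) * weight L κ := hiter n U V z κ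
      _ ≤ dist U V / 2 ^ n * Real.exp (rate L) * (4 * L ^ 2) := by gcongr
      _ = dist U V * (Real.exp (rate L) * (4 * L ^ 2)) / 2 ^ n := by ring
      _ ≤ dist U V * (2 ^ n / 2) / 2 ^ n := by
        gcongr
        linarith
      _ = _ := by push_cast; field_simp
  have hfix : Function.IsFixedPt Ψ _ := hcontr.isFixedPt_fixedPoint_iterate
  let U := ContractingWith.fixedPoint Ψ^[n] hcontr
  exact ⟨U, fun S x ξ hx => value_ofFun_of_eq U
    (k := fun S => picard A B C Kg S (ofFun U S))
    (fun z => (congrArg (fun V : C(Ω × triangle, Idx → ℝ) => V z) hfix).symm) S hx⟩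

end Existence

end KernelTriple

/-! ### Approximation of the kernels by neurons -/

namespace KernelTriple

/-- There are six components, and `6 * (ε / 3) ^ 2 ≤ ε ^ 2`. -/
theorem norm_toLp_le_of_abs_le {v : Idx → ℝ} {ε : ℝ} (hε : 0 ≤ ε) (h : ∀ κ, |v κ| ≤ ε / 3) :
    ‖WithLp.toLp 2 v‖ ≤ ε := by
  rw [EuclideanSpace.norm_eq]
  refine Real.sqrt_le_iff.2 ⟨hε, ?_⟩
  have h1 : ∀ κ ∈ Finset.univ, ‖(WithLp.toLp 2 v) κ‖ ^ 2 ≤ (ε / 3) ^ 2 := fun κ _ =>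
    pow_le_pow_left₀ (norm_nonneg _) (h κ) 2
  have hcard : (Finset.univ : Finset Idx).card = 6 := rfl
  refine (Finset.sum_le_card_nsmul _ _ _ h1).trans ?_
  rw [hcard, nsmul_eq_mul]
  push_cast
  nlinarith [sq_nonneg ε]

variable {Ω : Set SystemParam}

/-- Each component of a continuous family of kernels is approximated by sums of products of two
neurons, and the neurons for `γ` do not see `ξ`. -/
theorem exists_neurons_approx {σ : ℝ → ℝ} (hσ : Continuous σ)
    (hσ' : ¬ ∃ p : Polynomial ℝ, ∀ t, σ t = p.eval t) (hΩ : IsCompact Ω)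
    (U : C(Ω × triangle, Idx → ℝ)) {ε : ℝ} (hε : 0 < ε) (κ : Idx) :
    ∃ (n : ℕ) (c : Fin n → ℝ) (a : Fin n → SystemParam.Idx → ℝ) (b : Fin n → ℝ)
      (d : Fin n → Fin 2 → ℝ) (e : Fin n → ℝ),
      (∀ j, κ = .inr (.inr j) → ∀ i, d i 1 = 0) ∧
      ∀ (S : Ω) (x ξ : ℝ), (x, ξ) ∈ triangle →
        |(ofFun U S).value x ξ κ -
          ∑ i, c i * σ (a i ⬝ᵥ S.1.coords + b i) * σ (d i ⬝ᵥ ![x, ξ] + e i)| ≤ ε := by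
  have : CompactSpace Ω := isCompact_iff_compactSpace.1 hΩ
  have : CompactSpace triangle := isCompact_iff_compactSpace.1 isCompact_triangle
  have hp : Continuous fun S : Ω => S.1.coords :=
    SystemParam.continuous_coords.comp continuous_subtype_val
  have hp' : Function.Injective fun S : Ω => S.1.coords :=
    SystemParam.coords_injective.comp Subtype.val_injective
  have hq : Continuous fun p : triangle => ![p.1.1, p.1.2] := by fun_prop
  have hq' : Function.Injective fun p : triangle => ![p.1.1, p.1.2] := fun p q h =>
    Subtype.ext (Prod.ext (congrFun h 0) (congrFun h 1))
  obtain ⟨n, c, a, b, d, e, h⟩ := exists_sum_neuron_mul_neuron hσ hσ' hp hp' hq hq'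
    ⟨fun z => U z κ, by fun_prop⟩ hε
  rcases κ with (i | _ | j)
  · refine ⟨n, c, a, b, d, e, by simp, fun S x ξ hx => ?_⟩
    simpa [value, ofFun, triangleRetraction_of_mem hx] using h S ⟨_, hx⟩
  · refine ⟨n, c, a, b, d, e, by simp, fun S x ξ hx => ?_⟩
    simpa [value, ofFun, triangleRetraction_of_mem hx] using h S ⟨_, hx⟩
  -- For `γ` the approximation is redone over `Ω × [0, 1]`, and the weight of `ξ` is then set to
  -- zero.
  · have hr : Continuous fun x : Set.Icc (0 : ℝ) 1 => ![x.1] := by fun_prop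
    have hr' : Function.Injective fun x : Set.Icc (0 : ℝ) 1 => ![x.1] := fun x y h =>
      Subtype.ext (congrFun h 0)
    obtain ⟨n, c, a, b, d, e, h⟩ := exists_sum_neuron_mul_neuron hσ hσ' hp hp' hr hr'
      ⟨fun z => (ofFun U z.1).γ z.2.1 j, by fun_prop⟩ hε
    refine ⟨n, c, a, b, fun i => ![d i 0, 0], e, by simp, fun S x ξ hx => ?_⟩
    have hS := h S ⟨x, mem_Icc_of_mem_triangle hx⟩
    change |(ofFun U S).γ x j - _| ≤ ε at hS
    simpa [value, Matrix.vecHead] using hS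

end KernelTriple

/-! ### Assembly of the theorem -/

open KernelTriple in
theorem mainTheorem2
    (A : Matrix (Fin 2) (Fin 2) ℝ) (B : Fin 2 → ℝ) (C : Matrix (Fin 3) (Fin 2) ℝ)
    (Kg : Fin 2 → ℝ)
    (σ : ℝ → ℝ) (hσ : Continuous σ) (hσ' : ¬ ∃ p : Polynomial ℝ, ∀ t, σ t = p.eval t)
    (Ω : Set SystemParam) (hΩ : IsCompact Ω)
    (hpos : ∀ S ∈ Ω, (∀ i, 0 < S.lam i) ∧ 0 < S.lamMinus) :
    ∃ 𝒦 : SystemParam → KernelTriple,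
      (∀ S ∈ Ω, IsKernelSolution A B C Kg S (𝒦 S) ∧
        ∀ k, IsKernelSolution A B C Kg S k → k.EqOnDomain (𝒦 S)) ∧
      ∀ ε : ℝ, 0 < ε →
        ∃ G : DeepONet SystemParam.Idx (Fin 2) KernelTriple.Idx,
          (∀ S ∈ Ω, ∀ x ξ ξ' : ℝ, ∀ j : Fin 2,
            G.eval σ S.coords ![x, ξ] (.inr (.inr j)) =
              G.eval σ S.coords ![x, ξ'] (.inr (.inr j))) ∧
          ∀ S ∈ Ω, ∀ x ξ : ℝ, (x, ξ) ∈ triangle →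
            ‖WithLp.toLp 2 ((𝒦 S).value x ξ - G.eval σ S.coords ![x, ξ])‖ ≤ ε := by
  classical
  obtain ⟨L, hL⟩ := exists_coeffBound A B C hΩ fun S hS => (hpos S hS).2
  obtain ⟨U, hU⟩ := exists_fixed_ofFun Kg hΩ hL (fun S hS => (hpos S hS).1)
    fun S hS => (hpos S hS).2
  let 𝒦 : SystemParam → KernelTriple := fun S =>
    -- The value outside `Ω` is arbitrary and never examined.
    if h : S ∈ Ω then ofFun U ⟨S, h⟩ else ⟨0, 0, 0⟩
  have h𝒦 : ∀ S (hS : S ∈ Ω), 𝒦 S = ofFun U ⟨S, hS⟩ := fun S hS => dif_pos hS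
  refine ⟨𝒦, fun S hS => ?_, fun ε hε => ?_⟩
  · obtain ⟨hlam, hΛ⟩ := hpos S hS
    have hc := isContinuous_ofFun U ⟨S, hS⟩
    rw [h𝒦 S hS]
    exact ⟨(hU ⟨S, hS⟩).isKernelSolution hc hlam hΛ, fun k hk =>
      (hk.isPicardFixed hlam hΛ).eqOnDomain (hU ⟨S, hS⟩) (hL S hS) hlam hΛ hk.isRegular
        hc.isRegular⟩
  · choose n c a b d e hd happ using exists_neurons_approx hσ hσ' hΩ U (div_pos hε three_pos)
    obtain ⟨G, hG⟩ := exists_deepONet_eval_eq σ n c a b d e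
    refine ⟨G, fun S _ x ξ ξ' j => ?_, fun S hS x ξ hx => ?_⟩
    · rw [hG, hG]
      refine Finset.sum_congr rfl fun i _ => ?_
      simp [dotProduct, Fin.sum_univ_two, hd _ j rfl i]
    · refine norm_toLp_le_of_abs_le hε.le fun κ => ?_
      rw [Pi.sub_apply, hG, h𝒦 S hS]
      exact happ κ ⟨S, hS⟩ x ξ hx

end
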